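/- **Setting.** Let $b>0$, $\alpha>-1/2$. Consider the boundary value problem $$y''(x)+\frac{\alpha_2}{x}y'(x)+f(x,y(x))=0,\quad x\in(0,b],\qquad y'(0)=\alpha_1,\qquad \beta y(b)+\gamma y'(b)=\delta,$$ with real $\alpha_1,\alpha_2,\beta,\gamma,\delta$, $f:\mathbb R^2\to\mathbb R$, and assume $\beta\neq 0$ ("Assumption 1"). Let $G_n^{(\alpha)}$ be the Gegenbauer polynomials with $G_0=1$, $G_1=x$, $(n+2\alpha)G_{n+1}=2(n+\alpha)xG_n-nG_{n-1}$ ($n\ge1$). Put $q_n=G_{n+1}^{(\alpha)}-G_n^{(\alpha)}$, $q_{b,n}(x)=q_n(2x/b-1)$, let $x_{n,0}>\dots>x_{n,n}$ be the zeros of $q_n$ and $x_i=x_{b,n,i}^{(\alpha)}=\frac b2(x_{n,i}+1)\in(0,b]$ (the SFGGR nodes; $x_0=b$). Let $\mathbf Q^{(1)}$ be the $(n+1)\times(n+1)$ matrix sending the values of a function at $x_{n,0},\dots,x_{n,n}$ to the integrals $\int_{-1}^{x_{n,i}}$ of its interpolating polynomial of degree $\le n$ at these nodes, $\mathbf Q_b^{(1)}=\frac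 b2\mathbf Q^{(1)}$ and $Q^{(2)}_{b,i,k}=(x_i-x_k)Q^{(1)}_{b,i,k}$. For $\Phi\in\mathbb R^{n+1}$ the shifted Gegenbauer integral pseudospectral method (SGIPSM) uses the nodal values $$y''_{\mathrm{app}}(x_i)=\Phi_i,\qquad y'_{\mathrm{app}}(x_i)=\alpha_1+(\mathbf Q_b^{(1)}\Phi)_i,$$ $$y_{\mathrm{app}}(x_i)=\tfrac1\beta(\delta-\gamma\alpha_1)+\alpha_1(x_i-b)+\sum_{k=0}^n\Bigl(Q^{(2)}_{b,i,k}-Q^{(2)}_{b,0,k}-\tfrac\gamma\beta Q^{(1)}_{b,0,k}\Bigr)\Phi_k,$$ and its residual at the nodes is $$\mathcal R(x_i)=y''_{\mathrm{app}}(x_i)+\frac{\alpha_2}{x_i}y'_{\mathrm{app}}(x_i)+f(x_i,y_{\mathrm{app}}(x_i)).$$ Here $\Phi$ is either the vector of exact values $\Phi_i=y''(x_i)$, or any solution of the collocation system $\mathcal R(x_i)=0$, $i=0,\dots,n$ (for which the bounds are immediate). **Theorem.** Let $\beta\ne0$, $\lambda>0$ and let $y$ solve the boundary value problem. (1) Let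 $n\ge 0$, let $y$ be $C^{n+3}$ on $(0,b]$ with $\|y^{(n+k+2)}\|_{\infty,(0,b]}=A_k<\infty$ for $k=0,1$, and let $|f(x_i,u)-f(x_i,v)|\le\lambda|u-v|$ for all nodes $x_i=x_{b,n,i}^{(\alpha)}$ and all $u,v\in\mathbb R$. Then for $i=0,\dots,n$ $$|\mathcal R(x_i)|\le\frac{2^{-2n-1}\,\|q_{b,n}\|_{\infty,(0,b]}\,\Gamma(\alpha+1)\,b^{n+1}\,\Gamma(n+2\alpha+1)}{(n+1)!\,\Gamma(2\alpha+1)\,\Gamma(n+\alpha+1)}\Bigl(A_1\bigl(b\lambda(x_i+|\tfrac\gamma\beta|+b)+|\alpha_2|\bigr)+A_0\lambda(n+1)(x_i+b)\Bigr).$$ (2) There are positive constants $\mathcal L_1$ (if $\alpha\ge0$) and $\mathcal L_2$ (if $-1/2<\alpha<0$), depending only on $\lambda,b,\alpha$, such that the following holds. Suppose that $y$ is $C^\infty$ on $(0,b]$, that the norms $A_0=A_0(n)=\|y^{(n+2)}\|_{\infty,(0,b]}$, $n\ge0$, are finite and bounded by a constant independent of $n$, and that the Lipschitz condition of (1) holds,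 with the same $\lambda$, for every $n$. Then for all sufficiently large $n$ (depending on the problem and on $y$) and all $i=0,\dots,n$: if $\alpha\ge0$, $$|\mathcal R(x_i)|\le\mathcal L_1\Bigl(\frac e4\Bigr)^n b^{n+1}\begin{cases}n^{-n-\frac32+\alpha},&A_0=0,\\ n^{-n-\frac12+\alpha},&A_0\ne0,\end{cases}$$ and if $-1/2<\alpha<0$, $$|\mathcal R(x_i)|\le\mathcal L_2\Bigl(\frac e4\Bigr)^n b^{n+1}\begin{cases}n^{-n-\frac32},&A_0=0,\\ n^{-n-\frac12},&A_0\ne0.\end{cases}$$ -/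

import Mathlib

namespace LaneEmden

open Polynomial

/-- The Gegenbauer polynomial of degree `n` with parameter `α`, normalised to take the value `1`
at `1`, generated by `(n + 2α) G_{n+1} = 2 (n + α) x G_n - n G_{n-1}` for `n ≥ 1`. -/
noncomputable def gegenbauer (α : ℝ) : ℕ → ℝ[X]
  | 0 => 1
  | 1 => X
  | n + 2 => C (((n : ℝ) + 1 + 2 * α)⁻¹) *
      (C (2 * ((n : ℝ) + 1 + α)) * X * gegenbauer α (n + 1) - C ((n : ℝ) + 1) * gegenbauer α n)

/-- The polynomial `q_n = G_{n+1} - G_n`, of degree `n + 1`. -/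
noncomputable def qPoly (α : ℝ) (n : ℕ) : ℝ[X] :=
  gegenbauer α (n + 1) - gegenbauer α n

/-- The shifted polynomial function `q_{b,n}(x) = q_n(2x/b - 1)`. -/
noncomputable def qShifted (α b : ℝ) (n : ℕ) (x : ℝ) : ℝ :=
  (qPoly α n).eval (2 * x / b - 1)

/-- The flipped Gegenbauer-Gauss-Radau nodes on `[-1, 1]`: the `k`-th zero (`k = 0, …, n`) of
`q_n`, the zeros being sorted in descending order. -/
noncomputable def node (α : ℝ) (n : ℕ) (k : Fin (n + 1)) : ℝ :=
  ((qPoly α n).roots.sort (· ≥ ·)).getD k 0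

/-- The shifted nodes on `(0, b]`. -/
noncomputable def shiftedNode (α b : ℝ) (n : ℕ) (k : Fin (n + 1)) : ℝ :=
  b / 2 * (node α n k + 1)

/-- The first-order integration matrix on `[-1, 1]`: it maps the vector of nodal values of a
function to the vector of the integrals from `-1` to the `i`-th node of the polynomial of degree
at most `n` that interpolates the function at the nodes. Its `k`-th column is therefore obtained
from the `k`-th Lagrange basis polynomial. -/
noncomputable def Q1 (α : ℝ) (n : ℕ) : Matrix (Fin (n + 1)) (Fin (n + 1)) ℝ :=
  Matrix.of fun i k =>
    ∫ x in (-1 : ℝ)..node α n i, (Lagrange.basis Finset.univ (node α n) k).eval x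

/-- The first-order shifted integration matrix. -/
noncomputable def Qb1 (α b : ℝ) (n : ℕ) : Matrix (Fin (n + 1)) (Fin (n + 1)) ℝ :=
  (b / 2) • Q1 α n

/-- The second-order shifted integration matrix. -/
noncomputable def Qb2 (α b : ℝ) (n : ℕ) : Matrix (Fin (n + 1)) (Fin (n + 1)) ℝ :=
  Matrix.of fun i k => (shiftedNode α b n i - shiftedNode α b n k) * Qb1 α b n i k

/-- The uniform norm of a (bounded) function on a set. -/
noncomputable def supNorm (g : ℝ → ℝ) (S : Set ℝ) : ℝ :=
  sSup ((fun x => |g x|) '' S)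

/-- The data of the problem `y'' + (α₂ / x) y' + f(x, y) = 0` on `(0, b]`,
`y'(0) = α₁`, `β y(b) + γ y'(b) = δ`. -/
structure Problem where
  α₁ : ℝ
  α₂ : ℝ
  β : ℝ
  γ : ℝ
  δ : ℝ
  f : ℝ → ℝ → ℝ

/-- The `m`-th derivative of `y` on `(0, b]` (one-sided at `b`). -/
noncomputable def D (b : ℝ) (y : ℝ → ℝ) (m : ℕ) (x : ℝ) : ℝ :=
  iteratedDerivWithin m y (Set.Ioc 0 b) x

/-- `y` satisfies the Lane-Emden equation on `(0, b]` and both boundary conditions. -/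
structure Problem.IsSolution (P : Problem) (b : ℝ) (y : ℝ → ℝ) : Prop where
  equation : ∀ x ∈ Set.Ioc 0 b, D b y 2 x + P.α₂ / x * D b y 1 x + P.f x (y x) = 0
  left_bc : HasDerivWithinAt y P.α₁ (Set.Icc 0 b) 0
  right_bc : P.β * y b + P.γ * D b y 1 b = P.δ

/-- `f` is Lipschitz in its second variable, with constant `lam`, on the set
`{shifted nodes} × ℝ`. -/
def Problem.LipschitzAtNodes (P : Problem) (α b lam : ℝ) (n : ℕ) : Prop :=
  ∀ (i : Fin (n + 1)) (u v : ℝ),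
    |P.f (shiftedNode α b n i) u - P.f (shiftedNode α b n i) v| ≤ lam * |u - v|

/-- The matrix `H = I + α₂ diag(1 / x_i) Q_b^{(1)}`. -/
noncomputable def Problem.H (P : Problem) (α b : ℝ) (n : ℕ) :
    Matrix (Fin (n + 1)) (Fin (n + 1)) ℝ :=
  1 + P.α₂ • (Matrix.diagonal (fun i => 1 / shiftedNode α b n i) * Qb1 α b n)

/-- The vector `x̄`. -/
noncomputable def Problem.xbar (P : Problem) (α b : ℝ) (n : ℕ) (i : Fin (n + 1)) : ℝ :=
  1 / P.β * (P.δ - P.γ * P.α₁) + P.α₁ * (shiftedNode α b n i - b)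

/-- The matrix `Θ`: from each row of `Q_b^{(2)}` one subtracts the row
`Q_{b,0}^{(2)} + (γ / β) Q_{b,0}^{(1)}` (the zeroth node is `b`). -/
noncomputable def Problem.Θ (P : Problem) (α b : ℝ) (n : ℕ) :
    Matrix (Fin (n + 1)) (Fin (n + 1)) ℝ :=
  Matrix.of fun i k => Qb2 α b n i k - (Qb2 α b n 0 k + P.γ / P.β * Qb1 α b n 0 k)

/-- `Φ` solves the nonlinear collocation system of the method (case `β ≠ 0`). -/
def Problem.SolvesCollocation (P : Problem) (α b : ℝ) (n : ℕ) (Φ : Fin (n + 1) → ℝ) : Prop :=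
  ∀ i, (P.H α b n).mulVec Φ i
      + P.f (shiftedNode α b n i) (P.xbar α b n i + (P.Θ α b n).mulVec Φ i)
    = -(P.α₁ * P.α₂) * (1 / shiftedNode α b n i)

/-- Nodal values of the first derivative of the approximate solution whose second derivative has
the nodal values `Φ`. -/
noncomputable def Problem.appDeriv (P : Problem) (α b : ℝ) (n : ℕ) (Φ : Fin (n + 1) → ℝ)
    (i : Fin (n + 1)) : ℝ :=
  P.α₁ + (Qb1 α b n).mulVec Φ i

/-- Nodal values of the approximate solution whose second derivative has the nodal values `Φ`
(case `β ≠ 0`). -/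
noncomputable def Problem.appSol (P : Problem) (α b : ℝ) (n : ℕ) (Φ : Fin (n + 1) → ℝ)
    (i : Fin (n + 1)) : ℝ :=
  P.xbar α b n i + (P.Θ α b n).mulVec Φ i

/-- Nodal values of the residual `y_app'' + (α₂ / x) y_app' + f(x, y_app)` of the approximate
solution whose second derivative has the nodal values `Φ`. -/
noncomputable def Problem.residual (P : Problem) (α b : ℝ) (n : ℕ) (Φ : Fin (n + 1) → ℝ)
    (i : Fin (n + 1)) : ℝ :=
  Φ i + P.α₂ / shiftedNode α b n i * P.appDeriv α b n Φ i
    + P.f (shiftedNode α b n i) (P.appSol α b n Φ i)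

/-- The vectors `Φ` of nodal second derivatives for which the residual is considered: the sampled
values `y''(x_i)` of the solution, and the solutions of the collocation system, which the method
computes in their place. -/
def Problem.IsNodalVector (P : Problem) (α b : ℝ) (n : ℕ) (y : ℝ → ℝ)
    (Φ : Fin (n + 1) → ℝ) : Prop :=
  (∀ i, Φ i = D b y 2 (shiftedNode α b n i)) ∨ P.SolvesCollocation α b n Φ

/-- `‖y^{(m)}‖_{∞,(0,b]} = A`, the norm being finite. -/
def HasDerivNorm (b : ℝ) (y : ℝ → ℝ) (m : ℕ) (A : ℝ) : Prop :=
  IsLUB ((fun x => |D b y m x|) '' Set.Ioc 0 b) A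

end LaneEmden

/-! A solution of the collocation system has zero residual, so only the exact values `Φ i =
y''(x_i)` need work. Let `p` be the interpolant of `y''` at the nodes, after rescaling to `[-1, 1]`.
The nodes are `n + 1` distinct points of `(-1, 1]`, because `q_n` has only real simple zeros lying
there, so the Lagrange error formula bounds `|y'' - p|` by some `ε` proportional to `A₁ ‖q_n‖`
divided by `(n + 1)!` and the leading coefficient of `q_n`.

Integrating once, the error of `y'` at `x` is at most `ε x`; this cancels the singular factor `α₂ /
x`. Integrating again controls `y`, with one extra term: the matrix `Qb2` integrates the interpolant
of `(s - t) p(t)`, a polynomial of degree `n + 1`, and so misses a multiple of the nodal polynomial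
(`Qb2_mulVec`). The multiple is the leading coefficient of `p`, a divided difference of `y''`
bounded through `A₀`. Subtracting the differential equation and using the Lipschitz condition gives
`Problem.abs_residual_le`, from which the first bound follows.

For the asymptotics, Gauss's limit for the Gamma function estimates the leading coefficient, Sonin's
function gives `‖q_n‖ = O(n ^ max(-α, 0))`, and the increments of the primitive of `q_n` are smaller
by a further factor `n`. That gain cancels the factor `n + 1` beside `A₀`. With Stirling's formula
the residual is then `O(1 / n)` times the claimed rate, so every constant depending on the problem
is absorbed for large `n`, and the constants `1` suffice. If `A₀ = 0` then `A₁ = 0` too, and the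
residual vanishes. -/

namespace LaneEmden

open Polynomial

/-! ### Gegenbauer polynomials: recurrences, leading coefficient, derivative formulas. -/

section GegenbauerAlgebra

variable {α : ℝ}

theorem gegenbauer_zero (α : ℝ) : gegenbauer α 0 = 1 := by rw [gegenbauer]

theorem gegenbauer_one (α : ℝ) : gegenbauer α 1 = X := by rw [gegenbauer]

theorem natCast_add_one_add_pos (hα : -1 / 2 < α) (n : ℕ) : 0 < (n : ℝ) + 1 + 2 * α := by
  have : (0 : ℝ) ≤ n := n.cast_nonneg
  linarith

theorem gegenbauer_recurrence (hα : -1 / 2 < α) (n : ℕ) :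
    C ((n : ℝ) + 1 + 2 * α) * gegenbauer α (n + 2) =
      C (2 * ((n : ℝ) + 1 + α)) * X * gegenbauer α (n + 1) - C ((n : ℝ) + 1) * gegenbauer α n := by
  rw [gegenbauer, ← mul_assoc, ← C_mul, mul_inv_cancel₀ (natCast_add_one_add_pos hα n).ne', C_1,
    one_mul]

theorem gegenbauer_eval_recurrence (hα : -1 / 2 < α) (n : ℕ) (x : ℝ) :
    ((n : ℝ) + 1 + 2 * α) * (gegenbauer α (n + 2)).eval x =
      2 * ((n : ℝ) + 1 + α) * x * (gegenbauer α (n + 1)).eval x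
        - ((n : ℝ) + 1) * (gegenbauer α n).eval x := by
  simpa using congrArg (Polynomial.eval x) (gegenbauer_recurrence hα n)

theorem gegenbauer_derivative_recurrence (hα : -1 / 2 < α) (n : ℕ) (x : ℝ) :
    ((n : ℝ) + 1 + 2 * α) * (derivative (gegenbauer α (n + 2))).eval x =
      2 * ((n : ℝ) + 1 + α) * (gegenbauer α (n + 1)).eval x
        + 2 * ((n : ℝ) + 1 + α) * x * (derivative (gegenbauer α (n + 1))).eval x
        - ((n : ℝ) + 1) * (derivative (gegenbauer α n)).eval x := by
  have h := congrArg (fun p => Polynomial.eval x (derivative p)) (gegenbauer_recurrence hα n)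
  simp only [derivative_mul, derivative_C, derivative_sub, derivative_X, eval_add, eval_mul,
    eval_sub, eval_C, eval_X, zero_mul, zero_add, mul_one] at h
  linarith

theorem gegenbauer_aeval_recurrence (hα : -1 / 2 < α) (n : ℕ) (z : ℂ) :
    ((n : ℂ) + 1 + 2 * α) * aeval z (gegenbauer α (n + 2)) =
      2 * ((n : ℂ) + 1 + α) * z * aeval z (gegenbauer α (n + 1))
        - ((n : ℂ) + 1) * aeval z (gegenbauer α n) := by
  simpa using congrArg (aeval z) (gegenbauer_recurrence hα n)

/-- The leading coefficient of the Gegenbauer polynomial of degree `n + 1`. -/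
noncomputable def leadCoeff (α : ℝ) (n : ℕ) : ℝ :=
  ∏ j ∈ Finset.range n, 2 * ((j : ℝ) + 1 + α) / ((j : ℝ) + 1 + 2 * α)

theorem leadCoeff_pos (hα : -1 / 2 < α) (n : ℕ) : 0 < leadCoeff α n := by
  refine Finset.prod_pos fun j _ => ?_
  have h1 := natCast_add_one_add_pos hα j
  have : 0 < (j : ℝ) + 1 + α := by
    have : (0 : ℝ) ≤ j := j.cast_nonneg
    linarith
  positivity

theorem gegenbauer_natDegree_le (α : ℝ) (n : ℕ) : (gegenbauer α n).natDegree ≤ n := by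
  induction n using Nat.twoStepInduction with
  | zero => simp [gegenbauer_zero]
  | one => simp [gegenbauer_one]
  | more n ih0 ih1 =>
    rw [gegenbauer]
    compute_degree
    omega

theorem gegenbauer_coeff (α : ℝ) (n : ℕ) :
    (gegenbauer α (n + 1)).coeff (n + 1) = leadCoeff α n := by
  induction n with
  | zero => simp [gegenbauer_one, leadCoeff]
  | succ n ih =>
    have h0 : (gegenbauer α n).coeff (n + 2) = 0 :=
      coeff_eq_zero_of_natDegree_lt ((gegenbauer_natDegree_le α n).trans_lt (by omega))
    rw [gegenbauer, coeff_C_mul, coeff_sub, mul_assoc, coeff_C_mul, coeff_X_mul, coeff_C_mul, h0,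
      ih, leadCoeff, leadCoeff, Finset.prod_range_succ]
    ring

theorem qPoly_natDegree_le (α : ℝ) (n : ℕ) : (qPoly α n).natDegree ≤ n + 1 :=
  (natDegree_sub_le _ _).trans
    (max_le (gegenbauer_natDegree_le α _) ((gegenbauer_natDegree_le α _).trans (by omega)))

theorem qPoly_coeff (α : ℝ) (n : ℕ) : (qPoly α n).coeff (n + 1) = leadCoeff α n := by
  rw [qPoly, coeff_sub, gegenbauer_coeff, coeff_eq_zero_of_natDegree_lt (p := gegenbauer α n)
    ((gegenbauer_natDegree_le α n).trans_lt (by omega)), sub_zero]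

theorem qPoly_natDegree (hα : -1 / 2 < α) (n : ℕ) : (qPoly α n).natDegree = n + 1 :=
  natDegree_eq_of_le_of_coeff_ne_zero (qPoly_natDegree_le α n)
    (by rw [qPoly_coeff]; exact (leadCoeff_pos hα n).ne')

theorem qPoly_leadingCoeff (hα : -1 / 2 < α) (n : ℕ) :
    (qPoly α n).leadingCoeff = leadCoeff α n := by
  rw [leadingCoeff, qPoly_natDegree hα, qPoly_coeff]

theorem qPoly_ne_zero (hα : -1 / 2 < α) (n : ℕ) : qPoly α n ≠ 0 := by
  rw [← leadingCoeff_ne_zero, qPoly_leadingCoeff hα]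
  exact (leadCoeff_pos hα n).ne'

theorem leadCoeff_eq_Gamma (hα : -1 / 2 < α) (n : ℕ) :
    leadCoeff α n = 2 ^ n * Real.Gamma (n + α + 1) * Real.Gamma (2 * α + 1)
      / (Real.Gamma (α + 1) * Real.Gamma (n + 2 * α + 1)) := by
  have h1 : Real.Gamma (α + 1) ≠ 0 := (Real.Gamma_pos_of_pos (by linarith)).ne'
  have h2 : Real.Gamma (2 * α + 1) ≠ 0 := (Real.Gamma_pos_of_pos (by linarith)).ne'
  induction n with
  | zero =>
    simp only [leadCoeff, Finset.range_zero, Finset.prod_empty, pow_zero, one_mul, Nat.cast_zero,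
      zero_add]
    rw [mul_comm, div_self (mul_ne_zero h2 h1)]
  | succ n ih =>
    have h3 := natCast_add_one_add_pos hα n
    have h4 : 0 < (n : ℝ) + 1 + α := by
      have : (0 : ℝ) ≤ n := n.cast_nonneg
      linarith
    have h5 : Real.Gamma (n + 2 * α + 1) ≠ 0 := (Real.Gamma_pos_of_pos (by linarith)).ne'
    have e1 : ((n + 1 : ℕ) : ℝ) + α + 1 = (n + α + 1) + 1 := by push_cast; ring
    have e2 : ((n + 1 : ℕ) : ℝ) + 2 * α + 1 = (n + 2 * α + 1) + 1 := by push_cast; ring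
    rw [leadCoeff, Finset.prod_range_succ, ← leadCoeff, ih, e1, e2,
      Real.Gamma_add_one (s := n + α + 1) (by linarith),
      Real.Gamma_add_one (s := n + 2 * α + 1) (by linarith)]
    have h6 : (n : ℝ) + 2 * α + 1 ≠ 0 := by linarith
    field_simp
    ring

theorem gegenbauer_eval_one (hα : -1 / 2 < α) (n : ℕ) : (gegenbauer α n).eval 1 = 1 := by
  induction n using Nat.twoStepInduction with
  | zero => simp [gegenbauer_zero]
  | one => simp [gegenbauer_one]
  | more n ih0 ih1 =>
    have h := gegenbauer_eval_recurrence hα n 1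
    rw [ih0, ih1] at h
    have h3 := natCast_add_one_add_pos hα n
    exact mul_left_cancel₀ h3.ne' (by linarith)

theorem gegenbauer_eval_neg (hα : -1 / 2 < α) (n : ℕ) (x : ℝ) :
    (gegenbauer α n).eval (-x) = (-1) ^ n * (gegenbauer α n).eval x := by
  induction n using Nat.twoStepInduction with
  | zero => simp [gegenbauer_zero]
  | one => simp [gegenbauer_one]
  | more n ih0 ih1 =>
    have h := gegenbauer_eval_recurrence hα n x
    have h' := gegenbauer_eval_recurrence hα n (-x)
    rw [ih0, ih1] at h'
    refine mul_left_cancel₀ (natCast_add_one_add_pos hα n).ne' (h'.trans ?_)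
    linear_combination (-(-1) ^ n) * h

/-- The two derivative formulas
`(n + 1 + 2α) G_{n+2}' = (n + 2) (x G_{n+1}' + (n + 1 + 2α) G_{n+1})` and
`(1 - x²) G_{n+1}' = (n + 1) (G_n - x G_{n+1})`. -/
theorem gegenbauer_derivative_formulas (hα : -1 / 2 < α) (n : ℕ) (x : ℝ) :
    ((n : ℝ) + 1 + 2 * α) * (derivative (gegenbauer α (n + 2))).eval x =
        ((n : ℝ) + 2) * (x * (derivative (gegenbauer α (n + 1))).eval x
          + ((n : ℝ) + 1 + 2 * α) * (gegenbauer α (n + 1)).eval x) ∧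
      (1 - x ^ 2) * (derivative (gegenbauer α (n + 1))).eval x =
        ((n : ℝ) + 1) * ((gegenbauer α n).eval x - x * (gegenbauer α (n + 1)).eval x) := by
  induction n with
  | zero =>
    have h := gegenbauer_derivative_recurrence hα 0 x
    simp only [zero_add, gegenbauer_one, gegenbauer_zero, derivative_X, derivative_one, eval_one,
      eval_X, eval_zero] at h ⊢
    constructor
    · linear_combination h
    · push_cast; ring
  | succ n ih =>
    obtain ⟨hB, hC⟩ := ih
    have h0 := gegenbauer_eval_recurrence hα n x
    have h1 := gegenbauer_derivative_recurrence hα (n + 1) x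
    have hp := natCast_add_one_add_pos hα n
    -- The two formulas are proved together: both at `n` and the recurrence give the second at `n +
    -- 1`. The relation `hA`, obtained from the same three, then converts the differentiated
    -- recurrence into the first.
    have hC' : (1 - x ^ 2) * (derivative (gegenbauer α (n + 2))).eval x =
        ((n : ℝ) + 2) * ((gegenbauer α (n + 1)).eval x - x * (gegenbauer α (n + 2)).eval x) := by
      refine mul_left_cancel₀ hp.ne' ?_
      linear_combination (1 - x ^ 2) * hB + ((n : ℝ) + 2) * x * hC + ((n : ℝ) + 2) * x * h0
    refine ⟨?_, by push_cast; linear_combination hC'⟩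
    have hA : ((n : ℝ) + 1 + 2 * α) * (x * (derivative (gegenbauer α (n + 2))).eval x)
        - ((n : ℝ) + 2) * (derivative (gegenbauer α (n + 1))).eval x
        = ((n : ℝ) + 2) * ((n : ℝ) + 1 + 2 * α) * (gegenbauer α (n + 2)).eval x := by
      linear_combination x * hB - ((n : ℝ) + 2) * hC - ((n : ℝ) + 2) * h0
    push_cast at h1 ⊢
    linear_combination h1 + hA

end GegenbauerAlgebra

/-! ### Zeros of `q_n`: real, simple, in `(-1, 1]`; the nodes. -/

section Roots

variable {α : ℝ}

/-- A Christoffel-Darboux argument: the recurrence expresses this quantity at `n + 1` as a positive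
multiple of its value at `n` plus a nonnegative multiple of `(Im z)² |G_{n+1}(z)|²`. A nonreal zero
of `q_n` would make the product equal to `|G_n(z)|²`, which is real. -/
theorem im_mul_conj_gegenbauer_pos (hα : -1 / 2 < α) {z : ℂ} (hz : z.im ≠ 0) (n : ℕ) :
    0 < z.im * (aeval z (gegenbauer α (n + 1))
      * (starRingEnd ℂ) (aeval z (gegenbauer α n))).im := by
  induction n with
  | zero => simpa [gegenbauer_one, gegenbauer_zero] using mul_self_pos.mpr hz
  | succ n ih =>
    have h := gegenbauer_aeval_recurrence hα n z
    set g0 := aeval z (gegenbauer α n)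
    set g1 := aeval z (gegenbauer α (n + 1))
    set g2 := aeval z (gegenbauer α (n + 2))
    have hp := natCast_add_one_add_pos hα n
    have hr := congrArg Complex.re h
    have hi := congrArg Complex.im h
    simp only [Complex.mul_re, Complex.mul_im, Complex.sub_re, Complex.sub_im, Complex.add_re,
      Complex.add_im, Complex.natCast_re, Complex.natCast_im, Complex.one_re, Complex.one_im,
      Complex.ofReal_re, Complex.ofReal_im, Complex.re_ofNat, Complex.im_ofNat] at hr hi
    simp only [Complex.mul_im, Complex.conj_re, Complex.conj_im] at ih ⊢
    have hn : (0 : ℝ) ≤ n := n.cast_nonneg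
    have hq : 0 < (n : ℝ) + 1 + α := by linarith
    refine pos_of_mul_pos_right (a := (n : ℝ) + 1 + 2 * α) ?_ hp.le
    have key : ((n : ℝ) + 1 + 2 * α) * (z.im * (g2.re * -g1.im + g2.im * g1.re)) =
        2 * ((n : ℝ) + 1 + α) * (z.im ^ 2 * (g1.re ^ 2 + g1.im ^ 2))
          + ((n : ℝ) + 1) * (z.im * (g1.re * -g0.im + g1.im * g0.re)) := by
      linear_combination z.im * g1.re * hi - z.im * g1.im * hr
    rw [key]
    positivity

theorem im_eq_zero_of_aeval_qPoly_eq_zero (hα : -1 / 2 < α) {n : ℕ} {z : ℂ}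
    (hz : aeval z (qPoly α n) = 0) : z.im = 0 := by
  by_contra h
  have h1 := im_mul_conj_gegenbauer_pos hα h n
  rw [qPoly, map_sub, sub_eq_zero] at hz
  rw [hz, Complex.mul_conj, Complex.ofReal_im, mul_zero] at h1
  exact lt_irrefl _ h1

theorem qPoly_splits (hα : -1 / 2 < α) (n : ℕ) : (qPoly α n).Splits := by
  refine Splits.of_splits_map (algebraMap ℝ ℂ) (IsAlgClosed.splits _) fun z hz => ?_
  rw [mem_roots', IsRoot.def, eval_map_algebraMap] at hz
  exact ⟨z.re, Complex.ext rfl (im_eq_zero_of_aeval_qPoly_eq_zero hα hz.2).symm⟩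

/-- The confluent form of the same argument. At a double zero of `q_n` both the values and the
derivatives of `G_n` and `G_{n+1}` would agree, and this Wronskian would vanish. -/
theorem gegenbauer_wronskian_pos (hα : -1 / 2 < α) (n : ℕ) (x : ℝ) :
    0 < (derivative (gegenbauer α (n + 1))).eval x * (gegenbauer α n).eval x
      - (gegenbauer α (n + 1)).eval x * (derivative (gegenbauer α n)).eval x := by
  induction n with
  | zero => simp [gegenbauer_one, gegenbauer_zero]
  | succ n ih =>
    have h := gegenbauer_eval_recurrence hα n x
    have h' := gegenbauer_derivative_recurrence hα n x
    have hp := natCast_add_one_add_pos hα n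
    have hn : (0 : ℝ) ≤ n := n.cast_nonneg
    have hq : 0 < (n : ℝ) + 1 + α := by linarith
    refine pos_of_mul_pos_right (a := (n : ℝ) + 1 + 2 * α) ?_ hp.le
    have key : ((n : ℝ) + 1 + 2 * α) *
        ((derivative (gegenbauer α (n + 2))).eval x * (gegenbauer α (n + 1)).eval x
          - (gegenbauer α (n + 2)).eval x * (derivative (gegenbauer α (n + 1))).eval x) =
        2 * ((n : ℝ) + 1 + α) * (gegenbauer α (n + 1)).eval x ^ 2 + ((n : ℝ) + 1) *
        ((derivative (gegenbauer α (n + 1))).eval x * (gegenbauer α n).eval x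
          - (gegenbauer α (n + 1)).eval x * (derivative (gegenbauer α n)).eval x) := by
      linear_combination (gegenbauer α (n + 1)).eval x * h'
        - (derivative (gegenbauer α (n + 1))).eval x * h
    rw [key]
    positivity

theorem qPoly_roots_nodup (hα : -1 / 2 < α) (n : ℕ) : (qPoly α n).roots.Nodup := by
  refine Multiset.nodup_iff_count_le_one.mpr fun x => ?_
  rw [count_roots]
  by_contra! h
  obtain ⟨h1, h2⟩ := (one_lt_rootMultiplicity_iff_isRoot (qPoly_ne_zero hα n)).mp h
  have hw := gegenbauer_wronskian_pos hα n x
  simp only [qPoly, derivative_sub, IsRoot.def, eval_sub, sub_eq_zero] at h1 h2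
  rw [h1, h2, mul_comm, sub_self] at hw
  exact lt_irrefl _ hw

theorem gegenbauer_eval_pos_of_one_lt (hα : -1 / 2 < α) {x : ℝ} (hx : 1 < x) (n : ℕ) :
    0 < (gegenbauer α n).eval x ∧ (gegenbauer α n).eval x < (gegenbauer α (n + 1)).eval x := by
  induction n with
  | zero => simpa [gegenbauer_one, gegenbauer_zero] using hx
  | succ n ih =>
    obtain ⟨h0, h1⟩ := ih
    refine ⟨h0.trans h1, ?_⟩
    have h := gegenbauer_eval_recurrence hα n x
    have hp := natCast_add_one_add_pos hα n
    have hn : (0 : ℝ) ≤ n := n.cast_nonneg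
    have hq : 0 < (n : ℝ) + 1 + α := by linarith
    refine lt_of_mul_lt_mul_left ?_ hp.le
    rw [h]
    have h2 : 2 * ((n : ℝ) + 1 + α) * (gegenbauer α (n + 1)).eval x
        < 2 * ((n : ℝ) + 1 + α) * x * (gegenbauer α (n + 1)).eval x := by
      have := mul_lt_mul_of_pos_right hx
        (mul_pos (mul_pos two_pos hq) (h0.trans h1))
      linarith
    have h3 := mul_lt_mul_of_pos_left h1 (by linarith : (0 : ℝ) < n + 1)
    linarith

theorem qPoly_eval_one (hα : -1 / 2 < α) (n : ℕ) : (qPoly α n).eval 1 = 0 := by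
  rw [qPoly, eval_sub, gegenbauer_eval_one hα, gegenbauer_eval_one hα, sub_self]

theorem mem_Ioc_of_qPoly_isRoot (hα : -1 / 2 < α) {n : ℕ} {x : ℝ} (hx : (qPoly α n).eval x = 0) :
    x ∈ Set.Ioc (-1 : ℝ) 1 := by
  rw [qPoly, eval_sub, sub_eq_zero] at hx
  by_contra hmem
  rw [Set.mem_Ioc, not_and_or, not_lt, not_le] at hmem
  rcases hmem with h | h
  -- For `x ≤ -1` every `G_m(-x)` is positive, so by parity `G_n(x)` and `G_{n+1}(x)` have opposite
  -- signs and cannot coincide.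
  · have hpos : ∀ m, 0 < (gegenbauer α m).eval (-x) := by
      rcases h.eq_or_lt with rfl | h
      · intro m
        rw [neg_neg, gegenbauer_eval_one hα]
        exact one_pos
      · exact fun m => (gegenbauer_eval_pos_of_one_lt hα (by linarith) m).1
    have h1 := hpos n
    have h2 := hpos (n + 1)
    rw [gegenbauer_eval_neg hα] at h1 h2
    rw [hx, pow_succ] at h2
    linarith
  · exact (gegenbauer_eval_pos_of_one_lt hα h n).2.ne' hx

theorem length_sort_qPoly_roots (hα : -1 / 2 < α) (n : ℕ) :
    ((qPoly α n).roots.sort (· ≥ ·)).length = n + 1 := by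
  rw [Multiset.length_sort, ← (qPoly_splits hα n).natDegree_eq_card_roots, qPoly_natDegree hα]

/-- The list of zeros has exactly `n + 1` entries, so the default value in `node` is never taken. -/
theorem node_eq_getElem (hα : -1 / 2 < α) (n : ℕ) (k : Fin (n + 1)) :
    node α n k = ((qPoly α n).roots.sort (· ≥ ·))[(k : ℕ)]'
      (by rw [length_sort_qPoly_roots hα]; exact k.2) := by
  rw [node, List.getD_eq_getElem]

theorem node_mem_roots (hα : -1 / 2 < α) (n : ℕ) (k : Fin (n + 1)) :
    node α n k ∈ (qPoly α n).roots := by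
  rw [node_eq_getElem hα, ← Multiset.mem_sort (r := (· ≥ ·))]
  exact List.getElem_mem _

theorem qPoly_eval_node (hα : -1 / 2 < α) (n : ℕ) (k : Fin (n + 1)) :
    (qPoly α n).eval (node α n k) = 0 :=
  (mem_roots'.mp (node_mem_roots hα n k)).2

theorem node_mem_Ioc (hα : -1 / 2 < α) (n : ℕ) (k : Fin (n + 1)) :
    node α n k ∈ Set.Ioc (-1 : ℝ) 1 :=
  mem_Ioc_of_qPoly_isRoot hα (qPoly_eval_node hα n k)

theorem node_strictAnti (hα : -1 / 2 < α) (n : ℕ) : StrictAnti (node α n) := by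
  intro i j hij
  rw [node_eq_getElem hα, node_eq_getElem hα]
  have hnd : ((qPoly α n).roots.sort (· ≥ ·)).Nodup := by
    rw [← Multiset.coe_nodup, Multiset.sort_eq]
    exact qPoly_roots_nodup hα n
  have hs := List.pairwise_iff_getElem.mp ((qPoly α n).roots.pairwise_sort (· ≥ ·)) i j
    (by rw [length_sort_qPoly_roots hα]; exact i.2)
    (by rw [length_sort_qPoly_roots hα]; exact j.2) hij
  refine lt_of_le_of_ne hs fun he => ?_
  have := (hnd.getElem_inj_iff).mp he
  exact hij.ne' (Fin.ext this)

theorem node_injective (hα : -1 / 2 < α) (n : ℕ) : Function.Injective (node α n) :=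
  (node_strictAnti hα n).injective

/-- The zero `1` of `q_n` is the largest one. This places the right boundary condition at a node. -/
theorem node_zero (hα : -1 / 2 < α) (n : ℕ) : node α n 0 = 1 := by
  refine le_antisymm (node_mem_Ioc hα n 0).2 ?_
  have h1 : (1 : ℝ) ∈ (qPoly α n).roots.sort (· ≥ ·) := by
    rw [Multiset.mem_sort, mem_roots']
    exact ⟨qPoly_ne_zero hα n, qPoly_eval_one hα n⟩
  obtain ⟨k, hk, hk1⟩ := List.getElem_of_mem h1
  rw [length_sort_qPoly_roots hα] at hk
  have := node_eq_getElem hα n ⟨k, hk⟩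
  rw [hk1] at this
  rw [← this]
  exact (node_strictAnti hα n).antitone (Fin.zero_le _)

theorem qPoly_eq_C_mul_nodal (hα : -1 / 2 < α) (n : ℕ) :
    qPoly α n = C (leadCoeff α n) * Lagrange.nodal Finset.univ (node α n) := by
  rw [← sub_eq_zero]
  refine eq_zero_of_degree_lt_of_eval_index_eq_zero (s := Finset.univ)
    (node_injective hα n).injOn ?_ fun k _ => ?_
  · have hl := (leadCoeff_pos hα n).ne'

    refine (degree_sub_lt_left ?_ (qPoly_ne_zero hα n) ?_).trans_le ?_
    · rw [degree_C_mul hl, Lagrange.degree_nodal, degree_eq_natDegree (qPoly_ne_zero hα n),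
        qPoly_natDegree hα, Finset.card_univ, Fintype.card_fin]
    · rw [leadingCoeff_mul, leadingCoeff_C, Lagrange.nodal_monic.leadingCoeff, mul_one,
        qPoly_leadingCoeff hα]
    · rw [degree_eq_natDegree (qPoly_ne_zero hα n), qPoly_natDegree hα]
      simp
  · rw [eval_sub, qPoly_eval_node hα, eval_mul, Lagrange.eval_nodal_at_node (Finset.mem_univ k),
      mul_zero, sub_zero]

theorem eval_nodal_node (hα : -1 / 2 < α) (n : ℕ) (s : ℝ) :
    (Lagrange.nodal Finset.univ (node α n)).eval s
      = (leadCoeff α n)⁻¹ * (qPoly α n).eval s := by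
  rw [qPoly_eq_C_mul_nodal hα n, eval_mul, eval_C, inv_mul_cancel_left₀ (leadCoeff_pos hα n).ne']

end Roots

/-! ### Generalised Rolle theorem and Lagrange interpolation errors. -/

section Interpolation

/-- Generalised Rolle theorem: if `F 0, …, F m` are successive derivatives on an interval and
`F 0` has `m + 1` zeros there, then `F m` has a zero. -/
theorem exists_zero_of_card_zeros {S : Set ℝ} (hS : S.OrdConnected) {m : ℕ} :
    ∀ {F : ℕ → ℝ → ℝ}, (∀ k < m, ∀ x ∈ S, HasDerivWithinAt (F k) (F (k + 1) x) S x) →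
      ∀ T : Finset ℝ, T.card = m + 1 → (∀ t ∈ T, t ∈ S ∧ F 0 t = 0) → ∃ ξ ∈ S, F m ξ = 0 := by
  induction m with
  | zero =>
    intro F _ T hT hz
    obtain ⟨t, ht⟩ := Finset.card_pos.mp (by omega : 0 < T.card)
    exact ⟨t, hz t ht⟩
  | succ m ih =>
    intro F hF T hT hz
    set z := T.orderEmbOfFin hT with hzdef
    have hzT : ∀ i, z i ∈ S ∧ F 0 (z i) = 0 := fun i => hz _ (T.orderEmbOfFin_mem hT i)
    -- Rolle between consecutive zeros of `F 0`; these intervals do not overlap, so the `m + 1`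
    -- zeros of `F 1` are distinct.
    have hex : ∀ i : Fin (m + 1), ∃ w ∈ Set.Ioo (z i.castSucc) (z i.succ), F 1 w = 0 := by
      intro i
      have hlt : z i.castSucc < z i.succ := z.strictMono (Fin.castSucc_lt_succ)
      have hsub : Set.Icc (z i.castSucc) (z i.succ) ⊆ S := hS.out (hzT _).1 (hzT _).1
      refine exists_hasDerivAt_eq_zero (f := F 0) hlt ?_ ?_ ?_
      · exact fun x hx => ((hF 0 (by omega) x (hsub hx)).continuousWithinAt).mono hsub
      · rw [(hzT _).2, (hzT _).2]
      · exact fun x hx => (hF 0 (by omega) x (hsub (Set.Ioo_subset_Icc_self hx))).hasDerivAt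
          (Filter.mem_of_superset (Icc_mem_nhds hx.1 hx.2) hsub)
    choose w hw hw0 using hex
    have hwmono : StrictMono w := by
      intro i j hij
      have h1 : z i.succ ≤ z j.castSucc := by
        refine z.monotone ?_
        rw [Fin.le_def, Fin.val_succ, Fin.val_castSucc]
        exact hij
      exact ((hw i).2.trans_le h1).trans (hw j).1
    obtain ⟨ξ, hξ, h0⟩ := ih (F := fun k => F (k + 1))
      (fun k hk x hx => hF (k + 1) (by omega) x hx) (Finset.univ.image w)
      (by rw [Finset.card_image_of_injective _ hwmono.injective, Finset.card_univ,
        Fintype.card_fin]) (by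
        intro t ht
        obtain ⟨i, -, rfl⟩ := Finset.mem_image.mp ht
        exact ⟨hS.out (hzT _).1 (hzT _).1 (Set.Ioo_subset_Icc_self (hw i)), hw0 i⟩)
    exact ⟨ξ, hξ, h0⟩

theorem hasDerivWithinAt_sub_iterate_derivative {S : Set ℝ} {g : ℕ → ℝ → ℝ} {N : ℕ}
    (hg : ∀ k < N, ∀ x ∈ S, HasDerivWithinAt (g k) (g (k + 1) x) S x) (p : ℝ[X]) :
    ∀ k < N, ∀ x ∈ S, HasDerivWithinAt (fun t => g k t - (derivative^[k] p).eval t)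
      (g (k + 1) x - (derivative^[k + 1] p).eval x) S x := by
  intro k hk x hx
  rw [Function.iterate_succ_apply']
  exact (hg k hk x hx).sub (Polynomial.hasDerivWithinAt _ _ _)

theorem iterate_derivative_of_natDegree_le {p : ℝ[X]} {n : ℕ} (hp : p.natDegree ≤ n) (x : ℝ) :
    (derivative^[n] p).eval x = n.factorial * p.coeff n := by
  have h : (derivative^[n] p).natDegree ≤ 0 := by
    have := natDegree_iterate_derivative p n
    omega
  rw [eq_C_of_natDegree_le_zero h, eval_C, coeff_iterate_derivative, zero_add,
    Nat.descFactorial_self, nsmul_eq_mul]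

variable {S : Set ℝ} {g : ℕ → ℝ → ℝ} {n : ℕ} {v : Fin (n + 1) → ℝ} {p : ℝ[X]}

/-- The leading divided difference of a function is a value of its `n`-th derivative over `n!`. -/
theorem exists_coeff_eq (hS : S.OrdConnected)
    (hg : ∀ k < n, ∀ x ∈ S, HasDerivWithinAt (g k) (g (k + 1) x) S x)
    (hv : Function.Injective v) (hvS : ∀ i, v i ∈ S) (hp : p.natDegree ≤ n)
    (hpv : ∀ i, p.eval (v i) = g 0 (v i)) : ∃ ξ ∈ S, n.factorial * p.coeff n = g n ξ := by
  obtain ⟨ξ, hξ, h⟩ := exists_zero_of_card_zeros hS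
    (hasDerivWithinAt_sub_iterate_derivative hg p) (Finset.univ.image v)
    (by rw [Finset.card_image_of_injective _ hv, Finset.card_univ, Fintype.card_fin]) (by
      intro t ht
      obtain ⟨i, -, rfl⟩ := Finset.mem_image.mp ht
      exact ⟨hvS i, by simp [hpv]⟩)
  refine ⟨ξ, hξ, ?_⟩
  rw [iterate_derivative_of_natDegree_le hp] at h
  linarith

/-- The error formula of Lagrange interpolation. -/
theorem exists_interpolation_error_eq (hS : S.OrdConnected)
    (hg : ∀ k < n + 1, ∀ x ∈ S, HasDerivWithinAt (g k) (g (k + 1) x) S x)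
    (hv : Function.Injective v) (hvS : ∀ i, v i ∈ S) (hp : p.natDegree ≤ n)
    (hpv : ∀ i, p.eval (v i) = g 0 (v i)) {x : ℝ} (hx : x ∈ S) :
    ∃ ξ ∈ S, g 0 x - p.eval x =
      g (n + 1) ξ / (n + 1).factorial * (Lagrange.nodal Finset.univ v).eval x := by
  by_cases hxv : ∃ i, x = v i
  · obtain ⟨i, rfl⟩ := hxv
    exact ⟨v i, hx, by rw [hpv, Lagrange.eval_nodal_at_node (Finset.mem_univ i)]; ring⟩
  push Not at hxv
  set ω := Lagrange.nodal Finset.univ v with hω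
  have hωd : ω.natDegree = n + 1 := by
    rw [hω, Lagrange.natDegree_nodal, Finset.card_univ, Fintype.card_fin]
  have hωx : ω.eval x ≠ 0 := Lagrange.eval_nodal_not_at_node fun i _ => hxv i
  -- With this `c`, the function `g 0 - p - c ω` vanishes at `x` as well as at the `n + 1` nodes, so
  -- its derivative of order `n + 1` has a zero.
  set c := (g 0 x - p.eval x) / ω.eval x with hc
  have hxim : x ∉ Finset.univ.image v := by
    intro h
    obtain ⟨i, -, hi⟩ := Finset.mem_image.mp h
    exact hxv i hi.symm
  obtain ⟨ξ, hξ, h⟩ := exists_zero_of_card_zeros hS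
    (hasDerivWithinAt_sub_iterate_derivative hg (p + C c * ω)) (insert x (Finset.univ.image v))
    (by rw [Finset.card_insert_of_notMem hxim, Finset.card_image_of_injective _ hv,
      Finset.card_univ, Fintype.card_fin]) (by
      intro t ht
      rcases Finset.mem_insert.mp ht with rfl | ht
      · refine ⟨hx, ?_⟩
        simp only [Function.iterate_zero, id_eq, eval_add, eval_mul, eval_C, hc]
        rw [div_mul_cancel₀ _ hωx]
        ring
      · obtain ⟨i, -, rfl⟩ := Finset.mem_image.mp ht
        refine ⟨hvS i, ?_⟩
        simp [hpv, hω, Lagrange.eval_nodal_at_node (Finset.mem_univ i)])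
  refine ⟨ξ, hξ, ?_⟩
  have hdeg : (p + C c * ω).natDegree ≤ n + 1 := by
    refine natDegree_add_le_of_degree_le (hp.trans (Nat.le_succ n)) ?_
    exact (natDegree_C_mul_le _ _).trans hωd.le
  have hcoeff : (p + C c * ω).coeff (n + 1) = c := by
    rw [coeff_add, coeff_eq_zero_of_natDegree_lt (Nat.lt_succ_of_le hp), coeff_C_mul, zero_add,
      ← hωd, Monic.coeff_natDegree Lagrange.nodal_monic, mul_one]
  rw [iterate_derivative_of_natDegree_le hdeg, hcoeff, sub_eq_zero] at h
  rw [h, mul_div_cancel_left₀ _ (by positivity), hc, div_mul_cancel₀ _ hωx]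

end Interpolation

/-! ### A mean value estimate from a one-sided derivative at the endpoint. -/

section MeanValue

/-- A function `V` with `V = U'` on `(a, c]`, where `U` has vanishing derivative at `a`, inherits
the bound `|V x| ≤ C (x - a)` from `|V'| ≤ C`, although continuity of `V` at `a` is not assumed. -/
theorem abs_le_of_hasDerivWithinAt_Ioc {a c C : ℝ} {U V V' : ℝ → ℝ}
    (hU0 : HasDerivWithinAt U 0 (Set.Icc a c) a)
    (hU : ∀ x ∈ Set.Ioc a c, HasDerivWithinAt U (V x) (Set.Ioc a c) x)
    (hV : ∀ x ∈ Set.Ioc a c, HasDerivWithinAt V (V' x) (Set.Ioc a c) x)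
    (hC : ∀ x ∈ Set.Ioc a c, |V' x| ≤ C) {x : ℝ} (hx : x ∈ Set.Ioc a c) :
    |V x| ≤ C * (x - a) := by
  have hC0 : 0 ≤ C := (abs_nonneg _).trans (hC x hx)
  refine le_of_forall_pos_le_add fun δ hδ => ?_
  -- Near `a` the slopes of `U` are at most `δ`. The mean value theorem on `[a, t]` turns such a
  -- slope into a point `s` with `|V s| ≤ δ`, from which the bound on `V'` carries over to `x`.
  have hev : ∀ᶠ t in nhdsWithin a (Set.Ioc a c), |U t - U a| ≤ δ * |t - a| := by
    have h1 := (hasDerivWithinAt_iff_isLittleO.mp hU0).def hδ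
    filter_upwards [nhdsWithin_mono a Set.Ioc_subset_Icc_self h1] with t ht
    simpa using ht
  have hIoo : Set.Ioc a x ∈ nhdsWithin a (Set.Ioi a) := Ioc_mem_nhdsGT hx.1
  rw [nhdsWithin_Ioc_eq_nhdsGT (hx.1.trans_le hx.2)] at hev
  obtain ⟨t, ht, htx⟩ := (hev.and hIoo).exists
  have hsub : Set.Ioo a t ⊆ Set.Ioc a c := fun s hs => ⟨hs.1, hs.2.le.trans (htx.2.trans hx.2)⟩
  have hcont : ContinuousOn U (Set.Icc a t) := by
    intro s hs
    rcases hs.1.eq_or_lt with rfl | has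
    · exact hU0.continuousWithinAt.mono (Set.Icc_subset_Icc_right (htx.2.trans hx.2))
    · have h1 := (hU s ⟨has, hs.2.trans (htx.2.trans hx.2)⟩).continuousWithinAt
      refine (h1.mono_of_mem_nhdsWithin ?_)
      rw [mem_nhdsWithin]
      exact ⟨Set.Ioi a, isOpen_Ioi, has, fun r hr =>
        ⟨hr.1, hr.2.2.trans (htx.2.trans hx.2)⟩⟩
  obtain ⟨s, hs, hsV⟩ := exists_hasDerivAt_eq_slope U V htx.1 hcont fun s hs =>
    (hU s (hsub hs)).hasDerivAt (Filter.mem_of_superset (Ioo_mem_nhds hs.1 hs.2) hsub)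
  have hta : 0 < t - a := sub_pos.mpr htx.1
  have hVs : |V s| ≤ δ := by
    rw [hsV, abs_div, abs_of_pos hta, div_le_iff₀ hta]
    rwa [abs_of_pos hta] at ht
  have hVx : |V x - V s| ≤ C * |x - s| := by
    simpa using (convex_Ioc a c).norm_image_sub_le_of_norm_hasDerivWithin_le (f := V) (f' := V')
      hV hC (hsub hs) hx
  have hsx : s ≤ x := hs.2.le.trans htx.2
  rw [abs_of_nonneg (sub_nonneg.mpr hsx)] at hVx
  have h2 : C * (x - s) ≤ C * (x - a) :=
    mul_le_mul_of_nonneg_left (by linarith [hs.1]) hC0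
  have h3 : |V x| ≤ |V x - V s| + |V s| := by
    simpa using abs_add_le (V x - V s) (V s)
  linarith

end MeanValue

/-! ### Derivatives on `(0, b]` and rescaling to `(-1, 1]`. -/

section Derivatives

variable {b : ℝ} {y : ℝ → ℝ}

theorem hasDerivWithinAt_D {N m : ℕ} (hy : ContDiffOn ℝ N y (Set.Ioc 0 b))
    (hm : m < N) {x : ℝ} (hx : x ∈ Set.Ioc 0 b) :
    HasDerivWithinAt (D b y m) (D b y (m + 1) x) (Set.Ioc 0 b) x := by
  have hu : UniqueDiffOn ℝ (Set.Ioc 0 b) := uniqueDiffOn_Ioc 0 b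
  have h := (hy.differentiableOn_iteratedDerivWithin (m := m) (by exact_mod_cast hm) hu) x hx
  have h2 := h.hasDerivWithinAt
  rwa [← iteratedDerivWithin_succ] at h2

theorem half_mul_mem_Ioc (hb : 0 < b) {s : ℝ} (hs : s ∈ Set.Ioc (-1 : ℝ) 1) :
    b / 2 * (s + 1) ∈ Set.Ioc 0 b := by
  have h1 : 0 < s + 1 := by linarith [hs.1]
  refine ⟨by positivity, ?_⟩
  nlinarith [hs.2]

theorem hasDerivWithinAt_half_mul (b : ℝ) (S : Set ℝ) (s : ℝ) :
    HasDerivWithinAt (fun s : ℝ => b / 2 * (s + 1)) (b / 2) S s := by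
  simpa using ((hasDerivWithinAt_id s S).add_const 1).const_mul (b / 2)

theorem hasDerivWithinAt_D_comp {N m : ℕ} (hb : 0 < b) (hy : ContDiffOn ℝ N y (Set.Ioc 0 b))
    (hm : m < N) {s : ℝ} (hs : s ∈ Set.Ioc (-1 : ℝ) 1) :
    HasDerivWithinAt (fun s => D b y m (b / 2 * (s + 1)))
      (b / 2 * D b y (m + 1) (b / 2 * (s + 1))) (Set.Ioc (-1) 1) s := by
  have h := (hasDerivWithinAt_D hy hm (half_mul_mem_Ioc hb hs)).comp (h := fun s : ℝ => b / 2 * (s + 1)) s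
    (hasDerivWithinAt_half_mul b (Set.Ioc (-1) 1) s) fun t ht => half_mul_mem_Ioc hb ht
  rwa [mul_comm] at h

end Derivatives

/-! ### Action of the integration matrices in terms of primitives. -/

section IntegrationMatrices

/-- The primitive of a polynomial function that vanishes at `-1`. -/
noncomputable def primitive (p : ℝ[X]) (s : ℝ) : ℝ := ∫ t in (-1 : ℝ)..s, p.eval t

/-- The second primitive of a polynomial function that vanishes at `-1` to second order. -/
noncomputable def primitive₂ (p : ℝ[X]) (s : ℝ) : ℝ := ∫ t in (-1 : ℝ)..s, primitive p t

theorem primitive_hasDerivAt (p : ℝ[X]) (s : ℝ) : HasDerivAt (primitive p) (p.eval s) s :=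
  (p.continuous.integral_hasStrictDerivAt (-1) s).hasDerivAt

theorem continuous_primitive (p : ℝ[X]) : Continuous (primitive p) :=
  continuous_iff_continuousAt.mpr fun s => (primitive_hasDerivAt p s).continuousAt

theorem primitive₂_hasDerivAt (p : ℝ[X]) (s : ℝ) : HasDerivAt (primitive₂ p) (primitive p s) s :=
  ((continuous_primitive p).integral_hasStrictDerivAt (-1) s).hasDerivAt

@[simp] theorem primitive_neg_one (p : ℝ[X]) : primitive p (-1) = 0 := intervalIntegral.integral_same

@[simp] theorem primitive₂_neg_one (p : ℝ[X]) : primitive₂ p (-1) = 0 :=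
  intervalIntegral.integral_same

theorem primitive_add (p q : ℝ[X]) (s : ℝ) : primitive (p + q) s = primitive p s + primitive q s := by
  simp only [primitive, eval_add]
  exact intervalIntegral.integral_add (p.continuous.intervalIntegrable _ _)
    (q.continuous.intervalIntegrable _ _)

theorem primitive_C_mul (c : ℝ) (p : ℝ[X]) (s : ℝ) : primitive (C c * p) s = c * primitive p s := by
  simp only [primitive, eval_mul, eval_C]
  exact intervalIntegral.integral_const_mul _ _

theorem primitive_sum {ι : Type*} (S : Finset ι) (p : ι → ℝ[X]) (s : ℝ) :
    primitive (∑ k ∈ S, p k) s = ∑ k ∈ S, primitive (p k) s := by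
  simp only [primitive, eval_finsetSum]
  exact intervalIntegral.integral_finsetSum fun k _ => (p k).continuous.intervalIntegrable _ _

/-- Cauchy's formula for repeated integration, by parts. -/
theorem primitive_sub_X_mul (p : ℝ[X]) (s : ℝ) : primitive ((C s - X) * p) s = primitive₂ p s := by
  have h : ∀ t ∈ Set.uIcc (-1) s,
      HasDerivAt (fun t => (s - t) * primitive p t + primitive₂ p t) (((C s - X) * p).eval t) t := by
    intro t _
    have h1 := (((hasDerivAt_id t).const_sub s).mul (primitive_hasDerivAt p t)).add
      (primitive₂_hasDerivAt p t)
    refine h1.congr_deriv ?_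
    simp
  rw [primitive, intervalIntegral.integral_eq_sub_of_hasDerivAt h
    (((C s - X) * p).continuous.intervalIntegrable _ _)]
  simp

variable {α b : ℝ} {n : ℕ}

/-- The polynomial of degree at most `n` with the values `Φ` at the nodes. -/
noncomputable def nodeInterp (α : ℝ) (n : ℕ) (Φ : Fin (n + 1) → ℝ) : ℝ[X] :=
  Lagrange.interpolate Finset.univ (node α n) Φ

theorem nodeInterp_natDegree_le (hα : -1 / 2 < α) (Φ : Fin (n + 1) → ℝ) :
    (nodeInterp α n Φ).natDegree ≤ n := by
  have h := Lagrange.degree_interpolate_lt Φ (s := Finset.univ) (node_injective hα n).injOn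
  rw [Finset.card_univ, Fintype.card_fin] at h
  exact natDegree_le_iff_degree_le.mpr (Order.lt_succ_iff.mp (by exact_mod_cast h))

theorem nodeInterp_eval_node (hα : -1 / 2 < α) (Φ : Fin (n + 1) → ℝ) (i : Fin (n + 1)) :
    (nodeInterp α n Φ).eval (node α n i) = Φ i :=
  Lagrange.eval_interpolate_at_node Φ (node_injective hα n).injOn (Finset.mem_univ i)

theorem Qb1_mulVec (Φ : Fin (n + 1) → ℝ) (i : Fin (n + 1)) :
    (Qb1 α b n).mulVec Φ i = b / 2 * primitive (nodeInterp α n Φ) (node α n i) := by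
  rw [nodeInterp, Lagrange.interpolate_apply, primitive_sum, Finset.mul_sum, Matrix.mulVec,
    dotProduct]
  refine Finset.sum_congr rfl fun k _ => ?_
  rw [primitive_C_mul, Qb1, Q1, Matrix.smul_apply, Matrix.of_apply, smul_eq_mul, primitive]
  ring

/-- The left side interpolates `(s - t) p(t)`, whose degree may be `n + 1`. Adding the leading
coefficient of `p` times the monic nodal polynomial cancels the top term without changing the nodal
values, so uniqueness of interpolation applies. -/
theorem sum_node_sub_mul_basis (hα : -1 / 2 < α) (Φ : Fin (n + 1) → ℝ) (s : ℝ) :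
    ∑ k, C ((s - node α n k) * Φ k) * Lagrange.basis Finset.univ (node α n) k =
      (C s - X) * nodeInterp α n Φ
        + C ((nodeInterp α n Φ).coeff n) * Lagrange.nodal Finset.univ (node α n) := by
  symm
  have hnod : (Lagrange.nodal Finset.univ (node α n)).natDegree = n + 1 := by
    rw [Lagrange.natDegree_nodal, Finset.card_univ, Fintype.card_fin]
  have hp := nodeInterp_natDegree_le hα Φ
  rw [← Lagrange.interpolate_apply Finset.univ (node α n) fun k => (s - node α n k) * Φ k]
  refine Lagrange.eq_interpolate_of_eval_eq (s := Finset.univ) _ (node_injective hα n).injOn ?_ ?_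
  · rw [Finset.card_univ, Fintype.card_fin, degree_lt_iff_coeff_zero]
    intro m hm
    rw [coeff_add, sub_mul, coeff_sub, coeff_C_mul, coeff_C_mul,
      coeff_eq_zero_of_natDegree_lt (p := nodeInterp α n Φ) (by omega)]
    obtain ⟨m, rfl⟩ : ∃ k, m = k + 1 := ⟨m - 1, by omega⟩
    rw [coeff_X_mul]
    rcases (Nat.le_of_succ_le_succ hm).eq_or_lt with rfl | hm
    · have h1 := Monic.coeff_natDegree (Lagrange.nodal_monic (s := Finset.univ) (v := node α n))
      rw [hnod] at h1
      rw [h1]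
      ring
    · rw [coeff_eq_zero_of_natDegree_lt (p := nodeInterp α n Φ) (by omega),
        coeff_eq_zero_of_natDegree_lt (p := Lagrange.nodal Finset.univ (node α n)) (by omega)]
      ring
  · intro i _
    simp only [eval_add, eval_mul, eval_sub, eval_C, eval_X, nodeInterp_eval_node hα,
      Lagrange.eval_nodal_at_node (Finset.mem_univ i), mul_zero, add_zero]

/-- Second-order integration of the interpolant is not exact: the second summand is the defect, and
it is the source of the `A₀` term in the residual bound. -/
theorem Qb2_mulVec (hα : -1 / 2 < α) (Φ : Fin (n + 1) → ℝ) (i : Fin (n + 1)) :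
    (Qb2 α b n).mulVec Φ i = (b / 2) ^ 2 * (primitive₂ (nodeInterp α n Φ) (node α n i)
      + (nodeInterp α n Φ).coeff n
        * primitive (Lagrange.nodal Finset.univ (node α n)) (node α n i)) := by
  rw [← primitive_sub_X_mul, ← primitive_C_mul, ← primitive_add, ← sum_node_sub_mul_basis hα,
    primitive_sum, Finset.mul_sum, Matrix.mulVec, dotProduct]
  refine Finset.sum_congr rfl fun k _ => ?_
  rw [primitive_C_mul, Qb2, Qb1, Q1, Matrix.of_apply, Matrix.smul_apply, Matrix.of_apply,
    smul_eq_mul, primitive, shiftedNode, shiftedNode]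
  ring

end IntegrationMatrices

/-! ### The residual in terms of the interpolation error. -/

section Residual

variable {α b : ℝ} {n : ℕ}

theorem shiftedNode_mem_Ioc (hα : -1 / 2 < α) (hb : 0 < b) (i : Fin (n + 1)) :
    shiftedNode α b n i ∈ Set.Ioc 0 b :=
  half_mul_mem_Ioc hb (node_mem_Ioc hα n i)

theorem Problem.appSol_eq (P : Problem) (Φ : Fin (n + 1) → ℝ)
    (i : Fin (n + 1)) :
    P.appSol α b n Φ i = P.xbar α b n i
      + ((Qb2 α b n).mulVec Φ i
        - ((Qb2 α b n).mulVec Φ 0 + P.γ / P.β * (Qb1 α b n).mulVec Φ 0)) := by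
  rw [Problem.appSol]
  congr 1
  simp only [Matrix.mulVec, dotProduct, Problem.Θ, Matrix.of_apply, Finset.mul_sum]
  rw [← Finset.sum_add_distrib, ← Finset.sum_sub_distrib]
  exact Finset.sum_congr rfl fun k _ => by ring

theorem Problem.residual_eq_zero (P : Problem) {Φ : Fin (n + 1) → ℝ}
    (hΦ : P.SolvesCollocation α b n Φ) (i : Fin (n + 1)) : P.residual α b n Φ i = 0 := by
  have h := hΦ i
  rw [Problem.H, Matrix.add_mulVec, Matrix.one_mulVec, Matrix.smul_mulVec, Pi.add_apply,
    Pi.smul_apply, ← Matrix.mulVec_mulVec, Matrix.mulVec_diagonal, smul_eq_mul] at h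
  rw [Problem.residual, Problem.appDeriv, Problem.appSol]
  linear_combination h

/-- The errors of the nodal values of `y'` and `y` in terms of the interpolation error `ε` of
`y''` and of the leading coefficient of the interpolant. -/
theorem Problem.abs_residual_le_of_interpolation (P : Problem) (hα : -1 / 2 < α) (hb : 0 < b)
    {lam : ℝ} (hlam : 0 ≤ lam) {y : ℝ → ℝ} (hβ : P.β ≠ 0) (hsol : P.IsSolution b y)
    (hlip : P.LipschitzAtNodes α b lam n) (hy : ContDiffOn ℝ (2 : ℕ) y (Set.Ioc 0 b))
    {Φ : Fin (n + 1) → ℝ} (hΦ : ∀ i, Φ i = D b y 2 (shiftedNode α b n i)) {ε : ℝ}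
    (hε : ∀ s ∈ Set.Ioc (-1 : ℝ) 1,
      |D b y 2 (b / 2 * (s + 1)) - (nodeInterp α n Φ).eval s| ≤ ε)
    (i : Fin (n + 1)) :
    |P.residual α b n Φ i| ≤ |P.α₂| * ε + lam * (|P.γ / P.β| * (b * ε) + b * b * ε
      + (b / 2) ^ 2 * |(nodeInterp α n Φ).coeff n|
        * |primitive (Lagrange.nodal Finset.univ (node α n)) 1
          - primitive (Lagrange.nodal Finset.univ (node α n)) (node α n i)|) := by
  have hh : 0 < b / 2 := half_pos hb
  set h := b / 2 with hdef
  set p := nodeInterp α n Φ with hp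
  set S : Set ℝ := Set.Ioc (-1 : ℝ) 1 with hS
  have h1S : (1 : ℝ) ∈ S := ⟨by norm_num, le_rfl⟩
  have hε0 : 0 ≤ ε := (abs_nonneg _).trans (hε 1 h1S)
  -- `V` is the error of `y'`; `U` is the error of `y` up to the constants fixed by the boundary
  -- condition at `b`, and `U' = h V`.
  let V : ℝ → ℝ := fun s => D b y 1 (h * (s + 1)) - P.α₁ - h * primitive p s
  let U : ℝ → ℝ := fun s => y (h * (s + 1)) - P.α₁ * (h * (s + 1)) - h ^ 2 * primitive₂ p s
  have hD0 : D b y 0 = y := by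
    funext x
    simp [D]
  have hU : ∀ s ∈ S, HasDerivWithinAt U (h * V s) S s := by
    intro s hs
    have h0 := hasDerivWithinAt_D_comp hb hy (m := 0) (by norm_num) hs
    rw [hD0] at h0
    refine ((h0.sub ((hasDerivWithinAt_half_mul b S s).const_mul P.α₁)).sub
      ((primitive₂_hasDerivAt p s).hasDerivWithinAt.const_mul (h ^ 2))).congr_deriv ?_
    simp only [V, ← hdef]
    ring
  have hV : ∀ s ∈ S, HasDerivWithinAt (fun s => h * V s)
      (h * (h * (D b y 2 (h * (s + 1)) - p.eval s))) S s := by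
    intro s hs
    have h0 := hasDerivWithinAt_D_comp hb hy (m := 1) (by norm_num) hs
    refine (((h0.sub_const P.α₁).sub
      ((primitive_hasDerivAt p s).hasDerivWithinAt.const_mul h)).const_mul h).congr_deriv ?_
    simp only [← hdef]
    ring
  -- The condition at `0` enters only here, as a one-sided derivative; `y'` is not assumed
  -- continuous at `0`.
  have hU0 : HasDerivWithinAt U 0 (Set.Icc (-1) 1) (-1) := by
    have h0 : HasDerivWithinAt y P.α₁ (Set.Icc 0 b) (h * (-1 + 1)) := by
      simpa using hsol.left_bc
    have h1 := h0.comp (h := fun s : ℝ => h * (s + 1)) (-1)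
      (hasDerivWithinAt_half_mul b (Set.Icc (-1) 1) (-1)) (fun t ht => by
        refine ⟨mul_nonneg hh.le (by linarith [ht.1]), ?_⟩
        have := mul_le_mul_of_nonneg_left ht.2 hh.le
        simp only [hdef] at this ⊢
        linarith)
    refine ((h1.sub ((hasDerivWithinAt_half_mul b _ (-1)).const_mul P.α₁)).sub
      ((primitive₂_hasDerivAt p (-1)).hasDerivWithinAt.const_mul (h ^ 2))).congr_deriv ?_
    simp [← hdef]
  have hVb : ∀ s ∈ S, |V s| ≤ h * ε * (s + 1) := by
    intro s hs
    have h1 := abs_le_of_hasDerivWithinAt_Ioc hU0 hU hV (C := h * (h * ε)) (fun t ht => by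
      rw [abs_mul, abs_mul, abs_of_pos hh]
      gcongr
      exact hε t ht) hs
    rw [abs_mul, abs_of_pos hh] at h1
    refine le_of_mul_le_mul_left (h1.trans_eq ?_) hh
    ring
  set s := node α n i with hsdef
  have hsS : s ∈ S := node_mem_Ioc hα n i
  have hs1 : 0 < s + 1 := by linarith [hsS.1]
  have hb2 : b = 2 * h := by rw [hdef]; ring
  -- On the whole interval `|V| ≤ 2hε`, hence `|U'| ≤ 2h²ε`, and the length is at most `2`; the
  -- product is `4h²ε = b²ε`.
  have hUU : |U 1 - U s| ≤ b * b * ε := by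
    have h1 := (convex_Ioc (-1 : ℝ) 1).norm_image_sub_le_of_norm_hasDerivWithin_le (f := U)
      (f' := fun s => h * V s) (C := h * (h * ε * 2)) hU (fun t ht => by
        rw [Real.norm_eq_abs, abs_mul, abs_of_pos hh]
        gcongr
        refine (hVb t ht).trans ?_
        gcongr
        linarith [ht.2]) hsS h1S
    rw [Real.norm_eq_abs, Real.norm_eq_abs, abs_of_nonneg (sub_nonneg.mpr hsS.2)] at h1
    refine h1.trans ?_
    have h2 : 0 ≤ h * (h * ε * 2) := by positivity
    calc h * (h * ε * 2) * (1 - s) ≤ h * (h * ε * 2) * 2 := by gcongr; linarith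
      _ = b * b * ε := by rw [hb2]; ring
  have hx : shiftedNode α b n i = h * (s + 1) := rfl
  have hxpos : 0 < h * (s + 1) := mul_pos hh hs1
  have hder : P.appDeriv α b n Φ i = D b y 1 (h * (s + 1)) - V s := by
    rw [Problem.appDeriv, Qb1_mulVec]
    simp only [V, ← hp, ← hdef, ← hsdef]
    ring
  have hyb : y (h * (1 + 1)) = (P.δ - P.γ * D b y 1 (h * (1 + 1))) / P.β := by
    rw [show h * (1 + 1) = b by rw [hb2]; ring, eq_div_iff hβ]
    linear_combination hsol.right_bc
  -- Subtracting row `0` anchors the approximation at `b`, so `U` enters only through `U 1 - U s`;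
  -- eliminating `y(b)` by the boundary condition leaves `γ/β` times the derivative error at `b`.
  have hsolv : P.appSol α b n Φ i - y (h * (s + 1)) = P.γ / P.β * V 1 + (U 1 - U s)
      - h ^ 2 * p.coeff n * (primitive (Lagrange.nodal Finset.univ (node α n)) 1
          - primitive (Lagrange.nodal Finset.univ (node α n)) s) := by
    rw [P.appSol_eq, Qb2_mulVec hα, Qb2_mulVec hα, Qb1_mulVec, Problem.xbar, hx,
      node_zero hα, ← hp, ← hdef, ← hsdef]
    simp only [U, V]
    rw [hyb, hb2]
    ring
  have hres : P.residual α b n Φ i = -(P.α₂ / (h * (s + 1)) * V s)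
      + (P.f (h * (s + 1)) (P.appSol α b n Φ i) - P.f (h * (s + 1)) (y (h * (s + 1)))) := by
    have heq := hsol.equation _ (half_mul_mem_Ioc hb hsS)
    rw [Problem.residual, hΦ, hder, hx]
    linear_combination heq
  rw [hres]
  refine (abs_add_le _ _).trans (add_le_add ?_ ?_)
  · rw [abs_neg, abs_mul, abs_div, abs_of_pos hxpos]
    -- The bound on `V` is linear in `x_i = h (s + 1)`, which cancels the singular coefficient.
    calc |P.α₂| / (h * (s + 1)) * |V s|
        ≤ |P.α₂| / (h * (s + 1)) * (h * ε * (s + 1)) := by gcongr; exact hVb s hsS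
      _ = |P.α₂| * ε := by field_simp
  · refine (hlip i _ _).trans (mul_le_mul_of_nonneg_left ?_ hlam)
    rw [hsolv]
    refine (abs_sub _ _).trans ?_
    rw [abs_mul (h ^ 2 * _), abs_mul (h ^ 2), abs_of_nonneg (sq_nonneg h)]
    refine add_le_add ((abs_add_le _ _).trans (add_le_add ?_ hUU)) le_rfl
    rw [abs_mul]
    gcongr
    refine (hVb 1 h1S).trans_eq ?_
    rw [hb2]
    ring

end Residual

/-! ### The residual bound for fixed `n`. -/

section Bounds

variable {α b : ℝ} {n : ℕ}

/-- The chain of successive derivatives of the rescaled `y''`, in the form that the interpolation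
lemmas require. -/
theorem hasDerivWithinAt_scaled_D {N : ℕ} {y : ℝ → ℝ} (hb : 0 < b)
    (hy : ContDiffOn ℝ (N + 2 : ℕ) y (Set.Ioc 0 b)) :
    ∀ k < N, ∀ s ∈ Set.Ioc (-1 : ℝ) 1,
      HasDerivWithinAt (fun s => (b / 2) ^ k * D b y (k + 2) (b / 2 * (s + 1)))
        ((b / 2) ^ (k + 1) * D b y (k + 1 + 2) (b / 2 * (s + 1))) (Set.Ioc (-1) 1) s := by
  intro k hk s hs
  refine ((hasDerivWithinAt_D_comp hb hy (m := k + 2) (by omega) hs).const_mul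
    ((b / 2) ^ k)).congr_deriv ?_
  rw [show k + 2 + 1 = k + 1 + 2 by ring]
  ring

theorem HasDerivNorm.abs_le {y : ℝ → ℝ} {m : ℕ} {A : ℝ} (hA : HasDerivNorm b y m A) {x : ℝ}
    (hx : x ∈ Set.Ioc 0 b) : |D b y m x| ≤ A :=
  hA.1 ⟨x, hx, rfl⟩

theorem HasDerivNorm.nonneg {y : ℝ → ℝ} {m : ℕ} {A : ℝ} (hb : 0 < b)
    (hA : HasDerivNorm b y m A) : 0 ≤ A :=
  (abs_nonneg _).trans (hA.abs_le (Set.right_mem_Ioc.mpr hb))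

theorem abs_coeff_nodeInterp_le (hα : -1 / 2 < α) (hb : 0 < b) {y : ℝ → ℝ}
    (hy : ContDiffOn ℝ (n + 2 : ℕ) y (Set.Ioc 0 b)) {Φ : Fin (n + 1) → ℝ}
    (hΦ : ∀ i, Φ i = D b y 2 (shiftedNode α b n i)) {A₀ : ℝ}
    (hA₀ : HasDerivNorm b y (n + 2) A₀) :
    |(nodeInterp α n Φ).coeff n| ≤ (b / 2) ^ n / n.factorial * A₀ := by
  obtain ⟨ξ, hξ, h⟩ := exists_coeff_eq Set.ordConnected_Ioc (hasDerivWithinAt_scaled_D hb hy)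
    (node_injective hα n) (node_mem_Ioc hα n) (nodeInterp_natDegree_le hα Φ) fun i => by
      rw [nodeInterp_eval_node hα, hΦ, shiftedNode, pow_zero, one_mul]
  have hc : (nodeInterp α n Φ).coeff n
      = (b / 2) ^ n / n.factorial * D b y (n + 2) (b / 2 * (ξ + 1)) := by
    field_simp at h ⊢
    linear_combination h
  rw [hc, abs_mul, abs_of_nonneg (by positivity : 0 ≤ (b / 2) ^ n / (n.factorial : ℝ))]
  gcongr
  exact hA₀.abs_le (half_mul_mem_Ioc hb hξ)

theorem abs_sub_nodeInterp_le (hα : -1 / 2 < α) (hb : 0 < b) {y : ℝ → ℝ}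
    (hy : ContDiffOn ℝ (n + 3 : ℕ) y (Set.Ioc 0 b)) {Φ : Fin (n + 1) → ℝ}
    (hΦ : ∀ i, Φ i = D b y 2 (shiftedNode α b n i)) {A₁ : ℝ}
    (hA₁ : HasDerivNorm b y (n + 3) A₁) {M : ℝ}
    (hM : ∀ s ∈ Set.Ioc (-1 : ℝ) 1, |(qPoly α n).eval s| ≤ M) {s : ℝ}
    (hs : s ∈ Set.Ioc (-1 : ℝ) 1) :
    |D b y 2 (b / 2 * (s + 1)) - (nodeInterp α n Φ).eval s|
      ≤ (b / 2) ^ (n + 1) / (n + 1).factorial * ((leadCoeff α n)⁻¹ * M) * A₁ := by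
  obtain ⟨ξ, hξ, h⟩ := exists_interpolation_error_eq Set.ordConnected_Ioc
    (hasDerivWithinAt_scaled_D (N := n + 1) hb hy)
    (node_injective hα n) (node_mem_Ioc hα n) (nodeInterp_natDegree_le hα Φ) (fun i => by
      rw [nodeInterp_eval_node hα, hΦ, shiftedNode, pow_zero, one_mul]) hs
  have hl := leadCoeff_pos hα n
  rw [pow_zero, one_mul, zero_add] at h
  rw [h, eval_nodal_node hα, abs_mul, abs_div, abs_mul, abs_mul,
    abs_of_nonneg (by positivity : 0 ≤ (b / 2) ^ (n + 1)), abs_of_pos (inv_pos.mpr hl),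
    Nat.abs_cast]
  have h1 := hA₁.abs_le (half_mul_mem_Ioc hb hξ)
  have h2 := hM s hs
  calc (b / 2) ^ (n + 1) * |D b y (n + 1 + 2) (b / 2 * (ξ + 1))| / (n + 1).factorial
        * ((leadCoeff α n)⁻¹ * |(qPoly α n).eval s|)
      ≤ (b / 2) ^ (n + 1) * A₁ / (n + 1).factorial * ((leadCoeff α n)⁻¹ * M) := by
        have := hA₁.nonneg hb
        gcongr
    _ = _ := by ring

/-- The residual bound in terms of bounds for `q_n` and for its integrals. -/
theorem Problem.abs_residual_le (P : Problem) (hα : -1 / 2 < α) (hb : 0 < b)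
    {lam : ℝ} (hlam : 0 ≤ lam) {y : ℝ → ℝ} (hβ : P.β ≠ 0) (hsol : P.IsSolution b y)
    (hlip : P.LipschitzAtNodes α b lam n) (hy : ContDiffOn ℝ (n + 3 : ℕ) y (Set.Ioc 0 b))
    {A₀ A₁ : ℝ} (hA₀ : HasDerivNorm b y (n + 2) A₀) (hA₁ : HasDerivNorm b y (n + 3) A₁)
    {Φ : Fin (n + 1) → ℝ} (hΦ : P.IsNodalVector α b n y Φ) {M I : ℝ}
    (hM : ∀ s ∈ Set.Ioc (-1 : ℝ) 1, |(qPoly α n).eval s| ≤ M) (i : Fin (n + 1))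
    (hI : |primitive (qPoly α n) 1 - primitive (qPoly α n) (node α n i)| ≤ I) :
    |P.residual α b n Φ i| ≤
      (b / 2) ^ (n + 1) / (n + 1).factorial * (leadCoeff α n)⁻¹ *
        (M * A₁ * (|P.α₂| + lam * b * (|P.γ / P.β| + b))
          + lam * (b / 2) * (n + 1) * A₀ * I) := by
  have hl := leadCoeff_pos hα n
  have hA₀0 := hA₀.nonneg hb
  have hA₁0 := hA₁.nonneg hb
  have hM0 : 0 ≤ M := (abs_nonneg _).trans (hM 1 ⟨by norm_num, le_rfl⟩)
  have hI0 : 0 ≤ I := (abs_nonneg _).trans hI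
  rcases hΦ with hΦ | hΦ
  swap
  · rw [P.residual_eq_zero hΦ, abs_zero]
    positivity
  have h2 := P.abs_residual_le_of_interpolation hα hb hlam hβ hsol hlip
    (hy.of_le (by exact_mod_cast (by omega : 2 ≤ n + 3))) hΦ
    (fun s hs => abs_sub_nodeInterp_le hα hb hy hΦ hA₁ hM hs) i
  refine h2.trans ?_
  have hnod : Lagrange.nodal Finset.univ (node α n) = C (leadCoeff α n)⁻¹ * qPoly α n := by
    rw [qPoly_eq_C_mul_nodal hα n, ← mul_assoc, ← C_mul, inv_mul_cancel₀ hl.ne', C_1, one_mul]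
  have hc := abs_coeff_nodeInterp_le hα hb
    (hy.of_le (by exact_mod_cast (by omega : n + 2 ≤ n + 3))) hΦ hA₀
  have hfac : ((n + 1).factorial : ℝ) = (n + 1) * n.factorial := by
    rw [Nat.factorial_succ]
    push_cast
    ring
  have h3 : (b / 2) ^ 2 * |(nodeInterp α n Φ).coeff n|
        * |primitive (Lagrange.nodal Finset.univ (node α n)) 1
          - primitive (Lagrange.nodal Finset.univ (node α n)) (node α n i)|
      ≤ (b / 2) ^ 2 * ((b / 2) ^ n / n.factorial * A₀) * ((leadCoeff α n)⁻¹ * I) := by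
    rw [hnod, primitive_C_mul, primitive_C_mul, ← mul_sub, abs_mul, abs_of_pos (inv_pos.mpr hl)]
    gcongr
  have h4 := mul_le_mul_of_nonneg_left h3 hlam
  have h5 : lam * ((b / 2) ^ 2 * ((b / 2) ^ n / n.factorial * A₀) * ((leadCoeff α n)⁻¹ * I))
      = (b / 2) ^ (n + 1) / (n + 1).factorial * (leadCoeff α n)⁻¹
        * (lam * (b / 2) * (n + 1) * A₀ * I) := by
    rw [hfac]
    field_simp
    ring
  rw [h5] at h4
  rw [mul_add, mul_add, mul_add]
  refine (add_le_add_right (add_le_add_right h4 _) _).trans_eq ?_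
  ring

theorem abs_qPoly_eval_le_supNorm (α : ℝ) (hb : 0 < b) (n : ℕ) {s : ℝ}
    (hs : s ∈ Set.Ioc (-1 : ℝ) 1) :
    |(qPoly α n).eval s| ≤ supNorm (qShifted α b n) (Set.Ioc 0 b) := by
  have hcont : Continuous fun x => |qShifted α b n x| := by
    unfold qShifted
    fun_prop
  have hbdd : BddAbove ((fun x => |qShifted α b n x|) '' Set.Ioc 0 b) :=
    (isCompact_Icc.image hcont).bddAbove.mono (Set.image_mono Set.Ioc_subset_Icc_self)
  refine le_csSup hbdd ⟨b / 2 * (s + 1), half_mul_mem_Ioc hb hs, ?_⟩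
  simp only [qShifted]
  congr 2
  field_simp
  ring

theorem abs_primitive_sub_le {p : ℝ[X]} {M s : ℝ} (hs : s ∈ Set.Ioc (-1 : ℝ) 1)
    (hM : ∀ s ∈ Set.Ioc (-1 : ℝ) 1, |p.eval s| ≤ M) :
    |primitive p 1 - primitive p s| ≤ M * (1 - s) := by
  have h := (convex_Ioc (-1 : ℝ) 1).norm_image_sub_le_of_norm_hasDerivWithin_le (f := primitive p)
    (f' := fun s => p.eval s) (fun t _ => (primitive_hasDerivAt p t).hasDerivWithinAt) hM hs
    (⟨by norm_num, le_rfl⟩ : (1 : ℝ) ∈ Set.Ioc (-1 : ℝ) 1)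
  rwa [Real.norm_eq_abs, Real.norm_eq_abs, abs_of_nonneg (sub_nonneg.mpr hs.2)] at h

theorem inv_leadCoeff_eq_Gamma (hα : -1 / 2 < α) (n : ℕ) :
    (leadCoeff α n)⁻¹ = Real.Gamma (α + 1) * Real.Gamma (n + 2 * α + 1)
      / (2 ^ n * Real.Gamma (2 * α + 1) * Real.Gamma (n + α + 1)) := by
  rw [leadCoeff_eq_Gamma hα, inv_div]
  ring

theorem Problem.abs_residual_le_supNorm (P : Problem) (hα : -1 / 2 < α) (hb : 0 < b)
    {lam : ℝ} (hlam : 0 ≤ lam) {y : ℝ → ℝ} (hβ : P.β ≠ 0) (hsol : P.IsSolution b y)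
    (hlip : P.LipschitzAtNodes α b lam n) (hy : ContDiffOn ℝ (n + 3 : ℕ) y (Set.Ioc 0 b))
    {A₀ A₁ : ℝ} (hA₀ : HasDerivNorm b y (n + 2) A₀) (hA₁ : HasDerivNorm b y (n + 3) A₁)
    {Φ : Fin (n + 1) → ℝ} (hΦ : P.IsNodalVector α b n y Φ) (i : Fin (n + 1)) :
    |P.residual α b n Φ i| ≤
      ((2 : ℝ) ^ (-2 * (n : ℤ) - 1) * supNorm (qShifted α b n) (Set.Ioc 0 b)
          * Real.Gamma (α + 1) * b ^ (n + 1) * Real.Gamma (n + 2 * α + 1))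
        / ((n + 1).factorial * Real.Gamma (2 * α + 1) * Real.Gamma (n + α + 1))
      * (A₁ * (b * lam * (shiftedNode α b n i + |P.γ / P.β| + b) + |P.α₂|)
          + A₀ * lam * (n + 1) * (shiftedNode α b n i + b)) := by
  set M := supNorm (qShifted α b n) (Set.Ioc 0 b) with hMdef
  have hM : ∀ s ∈ Set.Ioc (-1 : ℝ) 1, |(qPoly α n).eval s| ≤ M := fun s hs =>
    abs_qPoly_eval_le_supNorm α hb n hs
  have hM0 : 0 ≤ M := (abs_nonneg _).trans (hM 1 ⟨by norm_num, le_rfl⟩)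
  have hl := leadCoeff_pos hα n
  have hA₀0 := hA₀.nonneg hb
  have hA₁0 := hA₁.nonneg hb
  have hx := shiftedNode_mem_Ioc hα hb i
  have h := P.abs_residual_le hα hb hlam hβ hsol hlip hy hA₀ hA₁ hΦ hM i
    (abs_primitive_sub_le (node_mem_Ioc hα n i) hM)
  have hpre : (2 : ℝ) ^ (-2 * (n : ℤ) - 1) * M
          * Real.Gamma (α + 1) * b ^ (n + 1) * Real.Gamma (n + 2 * α + 1)
        / ((n + 1).factorial * Real.Gamma (2 * α + 1) * Real.Gamma (n + α + 1))
      = (b / 2) ^ (n + 1) / (n + 1).factorial * (leadCoeff α n)⁻¹ * M := by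
    -- The power of two collects `2^(n+1)` from `(b / 2)^(n+1)` and `2^n` from the leading
    -- coefficient of `q_n`.
    have h2 : (2 : ℝ) ^ (-2 * (n : ℤ) - 1) = 1 / (2 ^ (n + 1) * 2 ^ n) := by
      rw [← pow_add, one_div, ← zpow_natCast, ← zpow_neg]
      congr 1
      push_cast
      ring
    rw [h2, inv_leadCoeff_eq_Gamma hα, div_pow]
    simp only [div_eq_mul_inv, mul_inv]
    ring
  rw [hpre]
  refine h.trans ?_
  rw [mul_assoc _ M]
  refine mul_le_mul_of_nonneg_left ?_ (by positivity)
  -- The target is weaker than what was obtained: `b - x_i` is enlarged to `b + x_i`, and the term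
  -- with `A₁ b λ x_i` (`h3`) is added.
  have h1 : b / 2 * (1 - node α n i) ≤ shiftedNode α b n i + b := by
    have : b / 2 * (1 - node α n i) = b - shiftedNode α b n i := by
      rw [shiftedNode]
      ring
    linarith [hx.1]
  have h2 : M * (A₀ * lam * (n + 1)) * (b / 2 * (1 - node α n i))
      ≤ M * (A₀ * lam * (n + 1)) * (shiftedNode α b n i + b) :=
    mul_le_mul_of_nonneg_left h1 (by positivity)
  have h3 : 0 ≤ M * A₁ * (b * lam * shiftedNode α b n i) := by
    have := hx.1
    positivity
  linear_combination h2 + h3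

end Bounds

/-! ### Growth in `n` of the leading coefficient, of `q_n` and of its primitive. -/

section GegenbauerBounds

variable {α : ℝ}

/-- The ratio of the sequences in Gauss's limit for `Γ(t)` and `Γ(s)` is this product times a power
of `n`; it converges, hence is bounded. -/
theorem exists_prod_ratio_le {s t : ℝ} (hs : 0 < s) (ht : 0 < t) :
    ∃ K : ℝ, 0 < K ∧ ∀ n : ℕ, 1 ≤ n →
      ∏ j ∈ Finset.range n, (s + j) / (t + j) ≤ K * (n : ℝ) ^ (s - t) := by
  have hlim := (Real.GammaSeq_tendsto_Gamma t).div (Real.GammaSeq_tendsto_Gamma s)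
    (Real.Gamma_pos_of_pos hs).ne'
  obtain ⟨K, hK⟩ := hlim.bddAbove_range
  have hK' : ∀ n, Real.GammaSeq t n / Real.GammaSeq s n ≤ |K| + 1 := fun n =>
    (hK ⟨n, rfl⟩).trans ((le_abs_self K).trans (by linarith))
  refine ⟨(|K| + 1) * (1 + t / s), by positivity, fun n hn => ?_⟩
  have hn0 : (0 : ℝ) < n := by exact_mod_cast hn
  have hps : 0 < ∏ j ∈ Finset.range (n + 1), (s + j) := Finset.prod_pos fun j _ => by positivity
  have hpt : 0 < ∏ j ∈ Finset.range (n + 1), (t + j) := Finset.prod_pos fun j _ => by positivity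
  have hfac : (0 : ℝ) < n.factorial := by positivity
  have hsn : 0 < (n : ℝ) ^ s := Real.rpow_pos_of_pos hn0 s
  have htn : 0 < (n : ℝ) ^ t := Real.rpow_pos_of_pos hn0 t
  have h1 : ∏ j ∈ Finset.range (n + 1), (s + j) / (t + j)
      = Real.GammaSeq t n / Real.GammaSeq s n * (n : ℝ) ^ (s - t) := by
    rw [Finset.prod_div_distrib, Real.GammaSeq, Real.GammaSeq, Real.rpow_sub hn0]
    field_simp
  -- `GammaSeq` has `n + 1` factors; removing the last one costs the bounded ratio `(t + n) / (s +
  -- n)`.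
  have h2 : ∏ j ∈ Finset.range n, (s + j) / (t + j)
      = (∏ j ∈ Finset.range (n + 1), (s + j) / (t + j)) * ((t + n) / (s + n)) := by
    rw [Finset.prod_range_succ]
    field_simp
  have h3 : (t + n) / (s + n) ≤ 1 + t / s := by
    rw [div_le_iff₀ (by positivity)]
    have : (1 + t / s) * (s + n) = s + n + t + t / s * n := by
      field_simp
      ring
    rw [this]
    have : 0 ≤ t / s * n := by positivity
    linarith
  rw [h2, h1]
  calc Real.GammaSeq t n / Real.GammaSeq s n * (n : ℝ) ^ (s - t) * ((t + n) / (s + n))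
      ≤ (|K| + 1) * (n : ℝ) ^ (s - t) * (1 + t / s) := by
        gcongr
        exact hK' n
    _ = _ := by ring

theorem exists_inv_leadCoeff_le (hα : -1 / 2 < α) :
    ∃ K : ℝ, 0 < K ∧ ∀ n : ℕ, 1 ≤ n → (leadCoeff α n)⁻¹ ≤ K * (n : ℝ) ^ α / 2 ^ n := by
  obtain ⟨K, hK0, hK⟩ := exists_prod_ratio_le (s := 1 + 2 * α) (t := 1 + α) (by linarith)
    (by linarith)
  refine ⟨K, hK0, fun n hn => ?_⟩
  have h := hK n hn
  rw [show 1 + 2 * α - (1 + α) = α by ring] at h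
  have h2n : (2 : ℝ) ^ n = ∏ _j ∈ Finset.range n, (2 : ℝ) := by simp
  have h1 : (leadCoeff α n)⁻¹
      = (∏ j ∈ Finset.range n, (1 + 2 * α + j) / (1 + α + j)) / 2 ^ n := by
    rw [leadCoeff, ← Finset.prod_inv_distrib, eq_div_iff (by positivity), h2n, ← Finset.prod_mul_distrib]
    refine Finset.prod_congr rfl fun j _ => ?_
    have := natCast_add_one_add_pos hα j
    have h2 : 0 < (j : ℝ) + 1 + α := by
      have : (0 : ℝ) ≤ j := j.cast_nonneg
      linarith
    rw [show 1 + 2 * α + (j : ℝ) = j + 1 + 2 * α by ring,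
      show 1 + α + (j : ℝ) = j + 1 + α by ring]
    field_simp
  rw [h1]
  gcongr

theorem gegenbauer_derivative_lower (hα : -1 / 2 < α) (n : ℕ) (x : ℝ) :
    ((n : ℝ) + 2 * α) * (x * (derivative (gegenbauer α (n + 1))).eval x)
        - ((n : ℝ) + 1) * (derivative (gegenbauer α n)).eval x
      = ((n : ℝ) + 1) * ((n : ℝ) + 2 * α) * (gegenbauer α (n + 1)).eval x := by
  cases n with
  | zero => simp [gegenbauer_zero, gegenbauer_one]
  | succ n =>
    obtain ⟨hB, hC⟩ := gegenbauer_derivative_formulas hα n x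
    have h0 := gegenbauer_eval_recurrence hα n x
    push_cast
    linear_combination x * hB - ((n : ℝ) + 2) * hC - ((n : ℝ) + 2) * h0

/-- Differentiate the formula for `(1 - x²) G_{n+1}'` and eliminate `G_n'` by
`gegenbauer_derivative_lower`. -/
theorem gegenbauer_differential_equation (hα : -1 / 2 < α) (n : ℕ) (x : ℝ) :
    (1 - x ^ 2) * (derivative (derivative (gegenbauer α (n + 1)))).eval x
      - (2 * α + 1) * x * (derivative (gegenbauer α (n + 1))).eval x
      + ((n : ℝ) + 1) * ((n : ℝ) + 1 + 2 * α) * (gegenbauer α (n + 1)).eval x = 0 := by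
  have hpoly : (1 - X ^ 2) * derivative (gegenbauer α (n + 1))
      = C ((n : ℝ) + 1) * (gegenbauer α n - X * gegenbauer α (n + 1)) := by
    refine Polynomial.funext fun t => ?_
    simpa using (gegenbauer_derivative_formulas hα n t).2
  have h := congrArg (fun p => Polynomial.eval x (derivative p)) hpoly
  simp only [derivative_mul, derivative_sub, derivative_one, derivative_X_pow, derivative_C,
    derivative_X, eval_add, eval_mul, eval_sub, eval_C, eval_X, eval_pow, eval_one,
    zero_mul, zero_add, one_mul, zero_sub, eval_neg, Nat.cast_ofNat, Nat.add_one_sub_one,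
    pow_one] at h
  linear_combination h - gegenbauer_derivative_lower hα n x

/-- The function `G² + (1 - x²) G'² / (m (m + 2α))` of Sonin for `G = G_m`, `m = n + 1`. -/
noncomputable def soninFun (α : ℝ) (n : ℕ) (x : ℝ) : ℝ :=
  (gegenbauer α (n + 1)).eval x ^ 2
    + (1 - x ^ 2) * (derivative (gegenbauer α (n + 1))).eval x ^ 2
      / (((n : ℝ) + 1) * ((n : ℝ) + 1 + 2 * α))

/-- The differential equation removes `G''` and leaves the sign of `α x`. On `[0, 1]` Sonin's
function is therefore increasing for `α ≥ 0`, where it is controlled by its value at `1`, and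
decreasing for `α < 0`, where it is controlled by its value at `0`. -/
theorem soninFun_hasDerivAt (hα : -1 / 2 < α) (n : ℕ) (x : ℝ) :
    HasDerivAt (soninFun α n) (4 * α * (x * ((derivative (gegenbauer α (n + 1))).eval x ^ 2
      / (((n : ℝ) + 1) * ((n : ℝ) + 1 + 2 * α))))) x := by
  have hp := natCast_add_one_add_pos hα n
  have hn : (0 : ℝ) < (n : ℝ) + 1 := by positivity
  have hode := gegenbauer_differential_equation hα n x
  have hG := (gegenbauer α (n + 1)).hasDerivAt x
  have hG' := (derivative (gegenbauer α (n + 1))).hasDerivAt x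
  refine ((hG.pow 2).add ((((hasDerivAt_pow 2 x).const_sub 1).mul (hG'.pow 2)).div_const
    (((n : ℝ) + 1) * ((n : ℝ) + 1 + 2 * α)))).congr_deriv ?_
  simp only [Pi.pow_apply]
  field_simp
  push_cast
  linear_combination 2 * (derivative (gegenbauer α (n + 1))).eval x * hode

theorem sq_gegenbauer_le_soninFun (hα : -1 / 2 < α) (n : ℕ) {x : ℝ} (hx : x ∈ Set.Icc (0 : ℝ) 1) :
    (gegenbauer α (n + 1)).eval x ^ 2 ≤ soninFun α n x := by
  have hp := natCast_add_one_add_pos hα n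
  have h1 : 0 ≤ 1 - x ^ 2 := by nlinarith [hx.1, hx.2]
  rw [soninFun, le_add_iff_nonneg_right]
  positivity

theorem continuous_soninFun (hα : -1 / 2 < α) (n : ℕ) : Continuous (soninFun α n) :=
  continuous_iff_continuousAt.mpr fun x => (soninFun_hasDerivAt hα n x).continuousAt

theorem abs_gegenbauer_eval_abs (hα : -1 / 2 < α) (n : ℕ) (x : ℝ) :
    |(gegenbauer α n).eval (|x|)| = |(gegenbauer α n).eval x| := by
  rcases abs_choice x with h | h
  · rw [h]
  · rw [h, gegenbauer_eval_neg hα, abs_mul, abs_pow, abs_neg, abs_one, one_pow, one_mul]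

theorem abs_mem_Icc {x : ℝ} (hx : x ∈ Set.Icc (-1 : ℝ) 1) : |x| ∈ Set.Icc (0 : ℝ) 1 :=
  ⟨abs_nonneg x, abs_le.mpr hx⟩

theorem abs_gegenbauer_le_one (hα : 0 ≤ α) (n : ℕ) {x : ℝ} (hx : x ∈ Set.Icc (-1 : ℝ) 1) :
    |(gegenbauer α n).eval x| ≤ 1 := by
  have hα' : -1 / 2 < α := by linarith
  cases n with
  | zero => simp [gegenbauer_zero]
  | succ n =>
    rw [← abs_gegenbauer_eval_abs hα']
    have hx' := abs_mem_Icc hx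
    have hp := natCast_add_one_add_pos hα' n
    have hmono : MonotoneOn (soninFun α n) (Set.Icc 0 1) := by
      refine monotoneOn_of_deriv_nonneg (convex_Icc 0 1) (continuous_soninFun hα' n).continuousOn
        (fun t _ => (soninFun_hasDerivAt hα' n t).differentiableAt.differentiableWithinAt)
        fun t ht => ?_
      rw [interior_Icc] at ht
      rw [(soninFun_hasDerivAt hα' n t).deriv]
      have := ht.1
      positivity
    have h1 : soninFun α n 1 = 1 := by simp [soninFun, gegenbauer_eval_one hα']
    have h2 := (sq_gegenbauer_le_soninFun hα' n hx').trans
      (hmono hx' (Set.right_mem_Icc.mpr zero_le_one) hx'.2)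
    rw [h1] at h2
    exact (sq_le_one_iff_abs_le_one _).mp h2

/-- At `x = 0` the middle term of the recurrence drops out, so even and odd degrees decouple. -/
theorem gegenbauer_eval_zero (hα : -1 / 2 < α) (k : ℕ) :
    |(gegenbauer α (2 * k)).eval 0| = ∏ j ∈ Finset.range k, (1 / 2 + (j : ℝ)) / (1 / 2 + α + j) ∧
      (gegenbauer α (2 * k + 1)).eval 0 = 0 := by
  induction k with
  | zero => simp [gegenbauer_zero, gegenbauer_one]
  | succ k ih =>
    have h0 := gegenbauer_eval_recurrence hα (2 * k) 0
    have h1 := gegenbauer_eval_recurrence hα (2 * k + 1) 0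
    have p0 := natCast_add_one_add_pos hα (2 * k)
    have p1 := natCast_add_one_add_pos hα (2 * k + 1)
    constructor
    · rw [Finset.prod_range_succ, ← ih.1]
      have h2 : (gegenbauer α (2 * (k + 1))).eval 0
          = -((gegenbauer α (2 * k)).eval 0 * ((1 / 2 + (k : ℝ)) / (1 / 2 + α + k))) := by
        refine mul_left_cancel₀ p0.ne' (h0.trans ?_)
        push_cast at p0 ⊢
        have h3 : (1 / 2 + (k : ℝ)) / (1 / 2 + α + k) = (2 * k + 1) / (2 * k + 1 + 2 * α) := by
          rw [div_eq_div_iff (by linarith) p0.ne']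
          ring
        rw [h3]
        field_simp
        ring
      have h3 : (0 : ℝ) ≤ (1 / 2 + (k : ℝ)) / (1 / 2 + α + k) := by
        push_cast at p0
        have : (0 : ℝ) < 1 / 2 + α + k := by linarith
        positivity
      rw [h2, abs_neg, abs_mul, abs_of_nonneg h3]
    · rw [ih.2] at h1
      exact mul_left_cancel₀ p1.ne' (h1.trans (by ring))

theorem exists_abs_gegenbauer_eval_zero_le (hα : -1 / 2 < α) (hα0 : α < 0) :
    ∃ K : ℝ, 0 < K ∧ ∀ n : ℕ, |(gegenbauer α n).eval 0| ≤ K * ((n : ℝ) + 1) ^ (-α) := by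
  obtain ⟨K, hK0, hK⟩ := exists_prod_ratio_le (s := 1 / 2) (t := 1 / 2 + α) (by norm_num)
    (by linarith)
  refine ⟨K + 1, by linarith, fun n => ?_⟩
  have hpow : 0 < ((n : ℝ) + 1) ^ (-α) := Real.rpow_pos_of_pos (by positivity) _
  obtain ⟨k, rfl | rfl⟩ := Nat.even_or_odd' n
  · rcases Nat.eq_zero_or_pos k with rfl | hk
    · simp only [mul_zero, gegenbauer_zero, eval_one, abs_one, Nat.cast_zero, zero_add,
        Real.one_rpow, mul_one]
      linarith
    · rw [(gegenbauer_eval_zero hα k).1]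
      refine (hK k hk).trans ?_
      rw [show 1 / 2 - (1 / 2 + α) = -α by ring]
      have h1 : (k : ℝ) ^ (-α) ≤ (((2 * k : ℕ) : ℝ) + 1) ^ (-α) := by
        refine Real.rpow_le_rpow k.cast_nonneg ?_ (by linarith)
        push_cast
        linarith [(k.cast_nonneg : (0 : ℝ) ≤ k)]
      exact mul_le_mul (by linarith) h1 (Real.rpow_nonneg k.cast_nonneg _) (by linarith)
  · rw [(gegenbauer_eval_zero hα k).2, abs_zero]
    positivity

theorem exists_abs_gegenbauer_le_of_neg (hα : -1 / 2 < α) (hα0 : α < 0) :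
    ∃ K : ℝ, 0 < K ∧ ∀ n : ℕ, ∀ x ∈ Set.Icc (-1 : ℝ) 1,
      |(gegenbauer α n).eval x| ≤ K * ((n : ℝ) + 1) ^ (-α) := by
  obtain ⟨K, hK0, hK⟩ := exists_abs_gegenbauer_eval_zero_le hα hα0
  have hα1 : 0 < 1 + 2 * α := by linarith
  -- `E` bounds `1 + (n + 1) / (n + 1 + 2α)`, the total weight of the squares of `G_{n+1}(0)` and
  -- `G_n(0)` in `soninFun α n 0`.
  set E : ℝ := 1 + 1 / (1 + 2 * α) with hE
  have hE1 : 1 ≤ E := by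
    have : 0 < 1 / (1 + 2 * α) := by positivity
    linarith
  refine ⟨(K + 1) * E, by positivity, fun n x hx => ?_⟩
  cases n with
  | zero =>
    simp only [gegenbauer_zero, eval_one, abs_one, Nat.cast_zero, zero_add, Real.one_rpow, mul_one]
    nlinarith
  | succ n =>
    rw [← abs_gegenbauer_eval_abs hα]
    have hx' := abs_mem_Icc hx
    have hp := natCast_add_one_add_pos hα n
    have hn : (0 : ℝ) ≤ n := n.cast_nonneg
    have hanti : AntitoneOn (soninFun α n) (Set.Icc 0 1) := by
      refine antitoneOn_of_deriv_nonpos (convex_Icc 0 1) (continuous_soninFun hα n).continuousOn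
        (fun t _ => (soninFun_hasDerivAt hα n t).differentiableAt.differentiableWithinAt)
        fun t ht => ?_
      rw [interior_Icc] at ht
      rw [(soninFun_hasDerivAt hα n t).deriv]
      have := ht.1
      exact mul_nonpos_of_nonpos_of_nonneg (by linarith) (by positivity)
    have hd : (derivative (gegenbauer α (n + 1))).eval 0
        = ((n : ℝ) + 1) * (gegenbauer α n).eval 0 := by
      have := (gegenbauer_derivative_formulas hα n 0).2
      linear_combination this
    set R : ℝ := (((n + 1 : ℕ) : ℝ) + 1) ^ (-α) with hR
    have hR0 : 0 < R := Real.rpow_pos_of_pos (by positivity) _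
    have hb1 : (gegenbauer α (n + 1)).eval 0 ^ 2 ≤ (K * R) ^ 2 := sq_le_sq'
      (abs_le.mp (hK (n + 1))).1 (abs_le.mp (hK (n + 1))).2
    have hb0 : (gegenbauer α n).eval 0 ^ 2 ≤ (K * R) ^ 2 := by
      have h1 : |(gegenbauer α n).eval 0| ≤ K * R := by
        refine (hK n).trans (mul_le_mul_of_nonneg_left ?_ hK0.le)
        refine Real.rpow_le_rpow (by positivity) ?_ (by linarith)
        push_cast
        linarith
      exact sq_le_sq' (abs_le.mp h1).1 (abs_le.mp h1).2
    have h0 : soninFun α n 0 ≤ (K * R) ^ 2 * E := by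
      have h1 : soninFun α n 0 = (gegenbauer α (n + 1)).eval 0 ^ 2
          + ((n : ℝ) + 1) / ((n : ℝ) + 1 + 2 * α) * (gegenbauer α n).eval 0 ^ 2 := by
        rw [soninFun, hd]
        field_simp
        ring
      have h2 : ((n : ℝ) + 1) / ((n : ℝ) + 1 + 2 * α) ≤ 1 / (1 + 2 * α) := by
        rw [div_le_div_iff₀ hp hα1]
        nlinarith
      rw [h1, hE, mul_add, mul_one, mul_comm _ (1 / (1 + 2 * α))]
      exact add_le_add hb1 (mul_le_mul h2 hb0 (sq_nonneg _) (by positivity))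
    have h2 := ((sq_gegenbauer_le_soninFun hα n hx').trans
      (hanti (Set.left_mem_Icc.mpr zero_le_one) hx' hx'.1)).trans h0
    refine abs_le_of_sq_le_sq (h2.trans ?_) (by positivity)
    calc (K * R) ^ 2 * E ≤ ((K + 1) * R) ^ 2 * (E * E) := by
          gcongr
          · linarith
          · nlinarith
      _ = ((K + 1) * E * R) ^ 2 := by ring

/-- On `[-1, 1]` the Gegenbauer polynomials are `O(n ^ max(-α, 0))`. -/
theorem exists_abs_gegenbauer_le (hα : -1 / 2 < α) :
    ∃ K : ℝ, 0 < K ∧ ∀ n : ℕ, ∀ x ∈ Set.Icc (-1 : ℝ) 1,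
      |(gegenbauer α n).eval x| ≤ K * ((n : ℝ) + 1) ^ (max (-α) 0) := by
  rcases le_or_gt 0 α with h | h
  · refine ⟨1, one_pos, fun n x hx => ?_⟩
    rw [max_eq_right (by linarith), Real.rpow_zero, one_mul]
    exact abs_gegenbauer_le_one h n hx
  · rw [max_eq_left (by linarith)]
    exact exists_abs_gegenbauer_le_of_neg hα h

/-- The increments of the primitives of the Gegenbauer polynomials are smaller than the
polynomials by a factor of order `n`. -/
theorem exists_abs_primitive_gegenbauer_le (hα : -1 / 2 < α) :
    ∃ K : ℝ, 0 < K ∧ ∀ n : ℕ, ∀ s ∈ Set.Icc (-1 : ℝ) 1,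
      |primitive (gegenbauer α (n + 2)) 1 - primitive (gegenbauer α (n + 2)) s|
        ≤ K * ((n : ℝ) + 4) ^ (max (-α) 0) / ((n : ℝ) + 2) := by
  obtain ⟨K, hK0, hK⟩ := exists_abs_gegenbauer_le hα
  have hα1 : 0 < 1 + 2 * α := by linarith
  set E : ℝ := 1 + |2 * α| + (2 + 2 / (1 + 2 * α)) with hE
  have hE0 : 0 < E := by positivity
  refine ⟨2 * (K * E), by positivity, fun n s hs => ?_⟩
  have hn : (0 : ℝ) ≤ n := n.cast_nonneg
  set R : ℝ := ((n : ℝ) + 4) ^ (max (-α) 0) with hR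
  have hR0 : 0 < R := Real.rpow_pos_of_pos (by positivity) _
  have hle : ∀ m : ℕ, m ≤ n + 3 → ∀ x ∈ Set.Icc (-1 : ℝ) 1,
      |(gegenbauer α m).eval x| ≤ K * R := by
    intro m hm x hx
    refine (hK m x hx).trans (mul_le_mul_of_nonneg_left ?_ hK0.le)
    refine Real.rpow_le_rpow (by positivity) ?_ (le_max_right _ _)
    have : (m : ℝ) ≤ n + 3 := by exact_mod_cast hm
    linarith
  have p1 : 0 < (n : ℝ) + 1 + 2 * α := by linarith
  set c₁ : ℝ := ((n : ℝ) + 2 + 2 * α) / ((n : ℝ) + 3) with hc₁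
  set c₂ : ℝ := ((n : ℝ) + 2) / ((n : ℝ) + 1 + 2 * α) with hc₂
  have hc₁0 : 0 ≤ c₁ := div_nonneg (by linarith) (by positivity)
  have hc₂0 : 0 ≤ c₂ := by positivity
  have hcE : c₁ + c₂ ≤ E := by
    have h1 : c₁ ≤ 1 + |2 * α| := by
      rw [hc₁, div_le_iff₀ (by positivity)]
      nlinarith [le_abs_self (2 * α), abs_nonneg (2 * α)]
    have h2 : c₂ ≤ 2 + 2 / (1 + 2 * α) := by
      rw [hc₂, div_le_iff₀ p1]
      have : (2 + 2 / (1 + 2 * α)) * ((n : ℝ) + 1 + 2 * α)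
          = 2 * (n + (1 + 2 * α)) + 2 + 2 * (n / (1 + 2 * α)) := by
        field_simp
        ring
      rw [this]
      have : 0 ≤ n / (1 + 2 * α) := by positivity
      linarith
    linarith
  -- A primitive of `2 (n + 2 + α) G_{n+2}` with bounded coefficients; dividing by `2 (n + 2 + α)`,
  -- which is at least `n + 2`, gives the gain.
  let H : ℝ → ℝ := fun x =>
    c₁ * (gegenbauer α (n + 3)).eval x - c₂ * (gegenbauer α (n + 1)).eval x
  have hHb : ∀ x ∈ Set.Icc (-1 : ℝ) 1, |H x| ≤ E * (K * R) := by
    intro x hx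
    refine (abs_sub _ _).trans ?_
    rw [abs_mul, abs_mul, abs_of_nonneg hc₁0, abs_of_nonneg hc₂0]
    calc c₁ * |(gegenbauer α (n + 3)).eval x| + c₂ * |(gegenbauer α (n + 1)).eval x|
        ≤ c₁ * (K * R) + c₂ * (K * R) := by
          gcongr
          · exact hle _ le_rfl x hx
          · exact hle _ (by omega) x hx
      _ = (c₁ + c₂) * (K * R) := by ring
      _ ≤ E * (K * R) := by gcongr
  have hHd : ∀ x, HasDerivAt H (2 * ((n : ℝ) + 2 + α) * (gegenbauer α (n + 2)).eval x) x := by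
    intro x
    refine (((gegenbauer α (n + 3)).hasDerivAt x).const_mul c₁ |>.sub
      (((gegenbauer α (n + 1)).hasDerivAt x).const_mul c₂)).congr_deriv ?_
    have hB := (gegenbauer_derivative_formulas hα (n + 1) x).1
    have hA := gegenbauer_derivative_lower hα (n + 1) x
    push_cast at hA hB
    have e1 : c₁ * (derivative (gegenbauer α (n + 3))).eval x
        = x * (derivative (gegenbauer α (n + 2))).eval x
          + ((n : ℝ) + 2 + 2 * α) * (gegenbauer α (n + 2)).eval x := by
      rw [hc₁, div_mul_eq_mul_div, div_eq_iff (by positivity)]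
      linear_combination hB
    have e2 : c₂ * (derivative (gegenbauer α (n + 1))).eval x
        = x * (derivative (gegenbauer α (n + 2))).eval x
          - ((n : ℝ) + 2) * (gegenbauer α (n + 2)).eval x := by
      rw [hc₂, div_mul_eq_mul_div, div_eq_iff p1.ne']
      linear_combination -hA
    rw [e1, e2]
    ring
  have hint : 2 * ((n : ℝ) + 2 + α) *
      (primitive (gegenbauer α (n + 2)) 1 - primitive (gegenbauer α (n + 2)) s) = H 1 - H s := by
    have hconst : ∀ x, HasDerivAt
        (fun x => 2 * ((n : ℝ) + 2 + α) * primitive (gegenbauer α (n + 2)) x - H x) 0 x := by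
      intro x
      refine (((primitive_hasDerivAt _ x).const_mul (2 * ((n : ℝ) + 2 + α))).sub
        (hHd x)).congr_deriv ?_
      ring
    have := is_const_of_deriv_eq_zero (fun x => (hconst x).differentiableAt)
      (fun x => (hconst x).deriv) 1 s
    linear_combination this
  have h1 : |H 1 - H s| ≤ 2 * (K * E) * R := by
    refine (abs_sub _ _).trans ?_
    linarith [hHb 1 ⟨by norm_num, le_rfl⟩, hHb s hs]
  have hpos : 0 < (n : ℝ) + 2 + α := by linarith
  rw [← hint, abs_mul, abs_of_pos (by positivity)] at h1
  rw [le_div_iff₀ (by positivity)]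
  refine le_trans ?_ h1
  rw [mul_comm]
  gcongr
  linarith

theorem exists_qPoly_bounds (hα : -1 / 2 < α) :
    ∃ K : ℝ, 0 < K ∧ ∀ n : ℕ, 2 ≤ n → ∀ s ∈ Set.Ioc (-1 : ℝ) 1,
      |(qPoly α n).eval s| ≤ K * (n : ℝ) ^ (max (-α) 0) ∧
      |primitive (qPoly α n) 1 - primitive (qPoly α n) s| ≤ K * (n : ℝ) ^ (max (-α) 0) / n := by
  obtain ⟨K₁, hK₁0, hK₁⟩ := exists_abs_gegenbauer_le hα
  obtain ⟨K₂, hK₂0, hK₂⟩ := exists_abs_primitive_gegenbauer_le hα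
  set μ := max (-α) 0 with hμ
  have hμ0 : 0 ≤ μ := le_max_right _ _
  have h3 : 0 < (3 : ℝ) ^ μ := Real.rpow_pos_of_pos (by norm_num) _
  refine ⟨2 * (K₁ + K₂) * 3 ^ μ, by positivity, fun n hn s hs => ?_⟩
  have hs' : s ∈ Set.Icc (-1 : ℝ) 1 := Set.Ioc_subset_Icc_self hs
  have hn2 : (2 : ℝ) ≤ n := by exact_mod_cast hn
  have hn0 : (0 : ℝ) < n := by linarith
  -- The bases that occur are at most `n + 3`, hence at most `3n` since `n ≥ 2`.
  have hpow : ∀ t : ℝ, 0 ≤ t → t ≤ 3 * n → t ^ μ ≤ 3 ^ μ * (n : ℝ) ^ μ := by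
    intro t ht0 ht
    rw [← Real.mul_rpow (by norm_num) hn0.le]
    exact Real.rpow_le_rpow ht0 ht hμ0
  have hnμ : 0 < (n : ℝ) ^ μ := Real.rpow_pos_of_pos hn0 _
  have hP : 0 < 3 ^ μ * (n : ℝ) ^ μ := by positivity
  constructor
  · have hG : ∀ m : ℕ, m ≤ n + 1 → |(gegenbauer α m).eval s| ≤ K₁ * (3 ^ μ * (n : ℝ) ^ μ) := by
      intro m hm
      refine (hK₁ m s hs').trans (mul_le_mul_of_nonneg_left (hpow _ (by positivity) ?_) hK₁0.le)
      have : (m : ℝ) ≤ n + 1 := by exact_mod_cast hm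
      linarith
    rw [qPoly, eval_sub]
    refine (abs_sub _ _).trans ((add_le_add (hG _ le_rfl) (hG _ (Nat.le_succ n))).trans ?_)
    have : 0 < K₂ * (3 ^ μ * (n : ℝ) ^ μ) := by positivity
    linarith
  · have hG : ∀ m : ℕ, n ≤ m → m ≤ n + 1 →
        |primitive (gegenbauer α m) 1 - primitive (gegenbauer α m) s|
          ≤ K₂ * (3 ^ μ * (n : ℝ) ^ μ) / n := by
      intro m hnm hm
      obtain ⟨k, rfl⟩ : ∃ k, m = k + 2 := ⟨m - 2, by omega⟩
      have h1 : (n : ℝ) ≤ k + 2 := by exact_mod_cast hnm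
      have h2 : (k : ℝ) + 2 ≤ n + 1 := by exact_mod_cast hm
      refine (hK₂ k s hs').trans ?_
      gcongr
      exact hpow _ (by positivity) (by linarith)
    have hsub : ∀ t, primitive (qPoly α n) t
        = primitive (gegenbauer α (n + 1)) t - primitive (gegenbauer α n) t := by
      intro t
      rw [show qPoly α n = gegenbauer α (n + 1) + C (-1) * gegenbauer α n by
        rw [qPoly, C_neg, C_1]; ring, primitive_add, primitive_C_mul]
      ring
    have hsplit : primitive (qPoly α n) 1 - primitive (qPoly α n) s
        = (primitive (gegenbauer α (n + 1)) 1 - primitive (gegenbauer α (n + 1)) s)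
          - (primitive (gegenbauer α n) 1 - primitive (gegenbauer α n) s) := by
      rw [hsub, hsub]
      ring
    rw [hsplit]
    refine (abs_sub _ _).trans ((add_le_add (hG _ (Nat.le_succ n) le_rfl)
      (hG _ le_rfl (Nat.le_succ n))).trans ?_)
    rw [← add_div]
    gcongr
    have : 0 < K₁ * (3 ^ μ * (n : ℝ) ^ μ) := by positivity
    linarith

end GegenbauerBounds

/-! ### Stirling's formula and the asymptotic bounds. -/

section Asymptotics

variable {α b : ℝ}

/-- Stirling's lower bound for `n!`, with `√(2πn)` weakened to `√n`; the remaining factor `n + 1 ≥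
n` supplies the division by `n`, the spare factor of the asymptotics. -/
theorem inv_factorial_succ_le {n : ℕ} (hn : 1 ≤ n) :
    ((n + 1).factorial : ℝ)⁻¹ ≤ Real.exp 1 ^ n * (n : ℝ) ^ (-(n : ℝ) - 1 / 2) / n := by
  have hn0 : (0 : ℝ) < n := by exact_mod_cast hn
  have hst := Stirling.le_factorial_stirling n
  have hsqrt : (n : ℝ) ^ (1 / 2 : ℝ) ≤ √(2 * Real.pi * n) := by
    rw [← Real.sqrt_eq_rpow]
    refine Real.sqrt_le_sqrt ?_
    nlinarith [Real.pi_gt_three]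
  have he : 0 < Real.exp 1 ^ n := by positivity
  have hpow : 0 < (n : ℝ) ^ (1 / 2 : ℝ) := Real.rpow_pos_of_pos hn0 _
  have h1 : (n : ℝ) ^ (1 / 2 : ℝ) * ((n : ℝ) ^ n / Real.exp 1 ^ n) ≤ n.factorial := by
    refine le_trans ?_ hst
    rw [div_pow]
    gcongr
  have h2 : (n : ℝ) ^ (-(n : ℝ) - 1 / 2) = ((n : ℝ) ^ (1 / 2 : ℝ) * (n : ℝ) ^ n)⁻¹ := by
    rw [← Real.rpow_natCast, ← Real.rpow_add hn0, ← Real.rpow_neg hn0.le]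
    congr 1
    ring
  have h3 : Real.exp 1 ^ n * (n : ℝ) ^ (-(n : ℝ) - 1 / 2) / n
      = (n * ((n : ℝ) ^ (1 / 2 : ℝ) * ((n : ℝ) ^ n / Real.exp 1 ^ n)))⁻¹ := by
    rw [h2]
    field_simp
  rw [h3]
  refine inv_anti₀ (by positivity) ?_
  rw [Nat.factorial_succ]
  push_cast
  refine mul_le_mul (by linarith) h1 (by positivity) (by positivity)

/-- If the derivatives of the solution are uniformly bounded, then the residual is `O(1 / n)`
times the function of `n` in the asymptotic bounds. -/
theorem Problem.exists_abs_residual_le (P : Problem) (hα : -1 / 2 < α) (hb : 0 < b)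
    {lam : ℝ} (hlam : 0 < lam) {y : ℝ → ℝ} (hβ : P.β ≠ 0) (hsol : P.IsSolution b y)
    (hlip : ∀ n, P.LipschitzAtNodes α b lam n) (hy : ContDiffOn ℝ (⊤ : ℕ∞) y (Set.Ioc 0 b))
    {A : ℕ → ℝ} (hA : ∀ n, HasDerivNorm b y (n + 2) (A n)) (hbdd : BddAbove (Set.range A)) :
    ∃ K : ℝ, ∀ n : ℕ, 2 ≤ n → ∀ Φ : Fin (n + 1) → ℝ, P.IsNodalVector α b n y Φ →
      ∀ i : Fin (n + 1), |P.residual α b n Φ i| ≤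
        K / n * ((Real.exp 1 / 4) ^ n * b ^ (n + 1) * (n : ℝ) ^ (-(n : ℝ) - 1 / 2 + max α 0)) := by
  obtain ⟨K₁, hK₁0, hK₁⟩ := exists_inv_leadCoeff_le hα
  obtain ⟨K₂, hK₂0, hK₂⟩ := exists_qPoly_bounds hα
  obtain ⟨B, hB⟩ := hbdd
  have hAB : ∀ n, A n ≤ B := fun n => hB ⟨n, rfl⟩
  have hA0 : ∀ n, 0 ≤ A n := fun n => (hA n).nonneg hb
  have hB0 : 0 ≤ B := (hA0 0).trans (hAB 0)
  set E : ℝ := |P.α₂| + lam * b * (|P.γ / P.β| + b) with hE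
  have hE0 : 0 ≤ E := by positivity
  refine ⟨K₁ * (K₂ * (B * E + lam * b * B)), fun n hn Φ hΦ i => ?_⟩
  have hn2 : (2 : ℝ) ≤ n := by exact_mod_cast hn
  have hn0 : (0 : ℝ) < n := by linarith
  set R : ℝ := (n : ℝ) ^ (max (-α) 0) with hR
  have hR0 : 0 < R := Real.rpow_pos_of_pos hn0 _
  have h := P.abs_residual_le hα hb hlam.le hβ hsol (hlip n)
    (contDiffOn_infty.mp hy (n + 3)) (hA n) (hA (n + 1)) hΦ (fun s hs => (hK₂ n hn s hs).1)
    i (hK₂ n hn _ (node_mem_Ioc hα n i)).2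
  have hbr : K₂ * R * A (n + 1) * E + lam * (b / 2) * (n + 1) * A n * (K₂ * R / n)
      ≤ K₂ * (B * E + lam * b * B) * R := by
    have h1 : K₂ * R * A (n + 1) * E ≤ K₂ * R * B * E := by
      gcongr
      exact hAB _
    -- The factor `n + 1` beside `A₀` is compensated by the gain `1 / n` in the primitive of `q_n`.
    have h2 : lam * (b / 2) * (n + 1) * A n * (K₂ * R / n)
        ≤ lam * (b / 2) * (n + n) * B * (K₂ * R / n) := by
      have := hA0 n
      gcongr
      · linarith
      · exact hAB _
    have h3 : lam * (b / 2) * (n + n) * B * (K₂ * R / n) = lam * b * B * K₂ * R := by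
      field_simp
      ring
    linarith
  have hfac := inv_factorial_succ_le (by omega : 1 ≤ n)
  have hl := hK₁ n (by omega)
  have hl0 := inv_pos.mpr (leadCoeff_pos hα n)
  have hbp : (b / 2) ^ (n + 1) ≤ b ^ (n + 1) / 2 ^ n := by
    rw [div_pow]
    gcongr
    · norm_num
    · omega
  -- The growth `n^α` of the inverse leading coefficient (beyond `2^(-n)`) and `n^max(-α, 0)` of
  -- `q_n` combine to `n^max(α, 0)`.
  have hpow : (n : ℝ) ^ (-(n : ℝ) - 1 / 2 + max α 0) = (n : ℝ) ^ (-(n : ℝ) - 1 / 2)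
      * ((n : ℝ) ^ α * R) := by
    rw [hR, ← Real.rpow_add hn0, ← Real.rpow_add hn0]
    congr 2
    rcases le_total 0 α with h | h
    · rw [max_eq_left h, max_eq_right (by linarith), add_zero]
    · rw [max_eq_right h, max_eq_left (by linarith), add_neg_cancel]
  refine h.trans ?_
  have hP : 0 < (n : ℝ) ^ (-(n : ℝ) - 1 / 2) := Real.rpow_pos_of_pos hn0 _
  have hα' : 0 < (n : ℝ) ^ α := Real.rpow_pos_of_pos hn0 _
  rw [div_eq_mul_inv ((b / 2) ^ (n + 1))]
  calc (b / 2) ^ (n + 1) * ((n + 1).factorial : ℝ)⁻¹ * (leadCoeff α n)⁻¹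
        * (K₂ * R * A (n + 1) * E + lam * (b / 2) * (n + 1) * A n * (K₂ * R / n))
      ≤ (b ^ (n + 1) / 2 ^ n) * (Real.exp 1 ^ n * (n : ℝ) ^ (-(n : ℝ) - 1 / 2) / n)
        * (K₁ * (n : ℝ) ^ α / 2 ^ n) * (K₂ * (B * E + lam * b * B) * R) := by
        have : 0 ≤ K₂ * R * A (n + 1) * E + lam * (b / 2) * (n + 1) * A n * (K₂ * R / n) := by
          have := hA0 n
          have := hA0 (n + 1)
          positivity
        gcongr
    _ = _ := by
        rw [hpow, div_pow, show (4 : ℝ) ^ n = 2 ^ n * 2 ^ n by rw [← mul_pow]; norm_num]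
        field_simp

theorem HasDerivNorm.eq_zero_succ {y : ℝ → ℝ} {m : ℕ} {A : ℝ} (hb : 0 < b)
    (h0 : HasDerivNorm b y m 0) (hA : HasDerivNorm b y (m + 1) A) : A = 0 := by
  have hz : ∀ x ∈ Set.Ioc 0 b, D b y m x = 0 := fun x hx => by
    simpa using h0.abs_le hx
  refine le_antisymm (hA.2 ?_) (hA.nonneg hb)
  rintro _ ⟨x, hx, rfl⟩
  have : D b y (m + 1) x = 0 := by
    rw [D, iteratedDerivWithin_succ]
    change derivWithin (D b y m) (Set.Ioc 0 b) x = 0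
    rw [derivWithin_congr (f := fun _ => (0 : ℝ)) hz (hz x hx)]
    simp
  simp [this]

/-- If `y^(n+2)` vanishes on `(0, b]`, so does `y^(n+3)`, and the bound for fixed `n` is zero. -/
theorem Problem.residual_eq_zero_of_norm_eq_zero (P : Problem) (hα : -1 / 2 < α) (hb : 0 < b)
    {lam : ℝ} (hlam : 0 ≤ lam) {n : ℕ} {y : ℝ → ℝ} (hβ : P.β ≠ 0) (hsol : P.IsSolution b y)
    (hlip : P.LipschitzAtNodes α b lam n) (hy : ContDiffOn ℝ (n + 3 : ℕ) y (Set.Ioc 0 b))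
    {A₁ : ℝ} (hA₀ : HasDerivNorm b y (n + 2) 0) (hA₁ : HasDerivNorm b y (n + 3) A₁)
    {Φ : Fin (n + 1) → ℝ} (hΦ : P.IsNodalVector α b n y Φ) (i : Fin (n + 1)) :
    P.residual α b n Φ i = 0 := by
  obtain rfl := hA₀.eq_zero_succ hb hA₁
  have h := P.abs_residual_le_supNorm hα hb hlam hβ hsol hlip hy hA₀ hA₁ hΦ i
  rw [← abs_nonpos_iff]
  refine h.trans_eq ?_
  ring

/-- The asymptotic bound for both signs of `α`, with the constant `1`. -/
theorem Problem.eventually_abs_residual_le (P : Problem) (hα : -1 / 2 < α) (hb : 0 < b)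
    {lam : ℝ} (hlam : 0 < lam) {y : ℝ → ℝ} (hβ : P.β ≠ 0) (hsol : P.IsSolution b y)
    (hlip : ∀ n, P.LipschitzAtNodes α b lam n) (hy : ContDiffOn ℝ (⊤ : ℕ∞) y (Set.Ioc 0 b))
    {A : ℕ → ℝ} (hA : ∀ n, HasDerivNorm b y (n + 2) (A n)) (hbdd : BddAbove (Set.range A)) :
    ∃ N : ℕ, ∀ n ≥ N, ∀ Φ : Fin (n + 1) → ℝ, P.IsNodalVector α b n y Φ →
      ∀ i : Fin (n + 1),
        (A n = 0 → P.residual α b n Φ i = 0) ∧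
        |P.residual α b n Φ i| ≤
          (Real.exp 1 / 4) ^ n * b ^ (n + 1) * (n : ℝ) ^ (-(n : ℝ) - 1 / 2 + max α 0) := by
  obtain ⟨K, hK⟩ := P.exists_abs_residual_le hα hb hlam hβ hsol hlip hy hA hbdd
  -- From this index on `K / n ≤ 1`, so the problem-dependent constant `K` affects only the
  -- threshold.
  refine ⟨max 2 ⌈K⌉₊, fun n hn Φ hΦ i => ⟨fun h0 => ?_, ?_⟩⟩
  · exact P.residual_eq_zero_of_norm_eq_zero hα hb hlam.le hβ hsol (hlip n)
      (contDiffOn_infty.mp hy (n + 3)) (h0 ▸ hA n) (hA (n + 1)) hΦ i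
  · have hn2 : 2 ≤ n := (le_max_left _ _).trans hn
    have hKn : K ≤ n := (Nat.le_ceil K).trans (by exact_mod_cast (le_max_right _ _).trans hn)
    have hn0 : (0 : ℝ) < n := by exact_mod_cast (by omega : 0 < n)
    have hP : 0 < (n : ℝ) ^ (-(n : ℝ) - 1 / 2 + max α 0) := Real.rpow_pos_of_pos hn0 _
    refine (hK n hn2 Φ hΦ i).trans (mul_le_of_le_one_left (by positivity) ?_)
    exact (div_le_one hn0).mpr hKn

end Asymptotics

end LaneEmden

/-! ### The theorem: fixed-`n` and asymptotic bounds together. -/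

theorem mainTheorem4 (α b lam : ℝ) (hα : -1 / 2 < α) (hb : 0 < b) (hlam : 0 < lam) :
    -- the bound for each `n`
    (∀ (P : LaneEmden.Problem) (y : ℝ → ℝ) (n : ℕ) (A₀ A₁ : ℝ),
      P.β ≠ 0 → P.IsSolution b y → P.LipschitzAtNodes α b lam n →
      ContDiffOn ℝ (n + 3 : ℕ) y (Set.Ioc 0 b) →
      LaneEmden.HasDerivNorm b y (n + 2) A₀ → LaneEmden.HasDerivNorm b y (n + 3) A₁ →
      ∀ Φ : Fin (n + 1) → ℝ, P.IsNodalVector α b n y Φ → ∀ i : Fin (n + 1),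
        |P.residual α b n Φ i| ≤
          ((2 : ℝ) ^ (-2 * (n : ℤ) - 1)
              * LaneEmden.supNorm (LaneEmden.qShifted α b n) (Set.Ioc 0 b)
              * Real.Gamma (α + 1) * b ^ (n + 1) * Real.Gamma (n + 2 * α + 1))
            / ((n + 1).factorial * Real.Gamma (2 * α + 1) * Real.Gamma (n + α + 1))
          * (A₁ * (b * lam * (LaneEmden.shiftedNode α b n i + |P.γ / P.β| + b) + |P.α₂|)
              + A₀ * lam * (n + 1) * (LaneEmden.shiftedNode α b n i + b)))
    ∧
    -- the asymptotic bound for `α ≥ 0`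
    (0 ≤ α → ∃ L₁ : ℝ, 0 < L₁ ∧ ∀ (P : LaneEmden.Problem) (y : ℝ → ℝ) (A : ℕ → ℝ),
      P.β ≠ 0 → P.IsSolution b y → (∀ n, P.LipschitzAtNodes α b lam n) →
      ContDiffOn ℝ (⊤ : ℕ∞) y (Set.Ioc 0 b) →
      (∀ n, LaneEmden.HasDerivNorm b y (n + 2) (A n)) → BddAbove (Set.range A) →
      ∃ N : ℕ, ∀ n ≥ N, ∀ Φ : Fin (n + 1) → ℝ, P.IsNodalVector α b n y Φ →
        ∀ i : Fin (n + 1),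
          (A n = 0 → |P.residual α b n Φ i| ≤
            L₁ * (Real.exp 1 / 4) ^ n * b ^ (n + 1) * (n : ℝ) ^ (-(n : ℝ) - 3 / 2 + α)) ∧
          (A n ≠ 0 → |P.residual α b n Φ i| ≤
            L₁ * (Real.exp 1 / 4) ^ n * b ^ (n + 1) * (n : ℝ) ^ (-(n : ℝ) - 1 / 2 + α)))
    ∧
    -- the asymptotic bound for `-1/2 < α < 0`
    (α < 0 → ∃ L₂ : ℝ, 0 < L₂ ∧ ∀ (P : LaneEmden.Problem) (y : ℝ → ℝ) (A : ℕ → ℝ),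
      P.β ≠ 0 → P.IsSolution b y → (∀ n, P.LipschitzAtNodes α b lam n) →
      ContDiffOn ℝ (⊤ : ℕ∞) y (Set.Ioc 0 b) →
      (∀ n, LaneEmden.HasDerivNorm b y (n + 2) (A n)) → BddAbove (Set.range A) →
      ∃ N : ℕ, ∀ n ≥ N, ∀ Φ : Fin (n + 1) → ℝ, P.IsNodalVector α b n y Φ →
        ∀ i : Fin (n + 1),
          (A n = 0 → |P.residual α b n Φ i| ≤
            L₂ * (Real.exp 1 / 4) ^ n * b ^ (n + 1) * (n : ℝ) ^ (-(n : ℝ) - 3 / 2)) ∧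
          (A n ≠ 0 → |P.residual α b n Φ i| ≤
            L₂ * (Real.exp 1 / 4) ^ n * b ^ (n + 1) * (n : ℝ) ^ (-(n : ℝ) - 1 / 2))) := by
  refine ⟨fun P y n A₀ A₁ hβ hsol hlip hy hA₀ hA₁ Φ hΦ i =>
    P.abs_residual_le_supNorm hα hb hlam.le hβ hsol hlip hy hA₀ hA₁ hΦ i,
    fun hα0 => ⟨1, one_pos, fun P y A hβ hsol hlip hy hA hbdd => ?_⟩,
    fun hα0 => ⟨1, one_pos, fun P y A hβ hsol hlip hy hA hbdd => ?_⟩⟩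
  · obtain ⟨N, hN⟩ := P.eventually_abs_residual_le hα hb hlam hβ hsol hlip hy hA hbdd
    refine ⟨N, fun n hn Φ hΦ i => ⟨fun h0 => ?_, fun _ => ?_⟩⟩
    · rw [(hN n hn Φ hΦ i).1 h0, abs_zero]
      positivity
    · have h := (hN n hn Φ hΦ i).2
      simpa only [one_mul, max_eq_left hα0] using h
  · obtain ⟨N, hN⟩ := P.eventually_abs_residual_le hα hb hlam hβ hsol hlip hy hA hbdd
    refine ⟨N, fun n hn Φ hΦ i => ⟨fun h0 => ?_, fun _ => ?_⟩⟩
    · rw [(hN n hn Φ hΦ i).1 h0, abs_zero]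
      positivity
    · have h := (hN n hn Φ hΦ i).2
      simpa only [one_mul, max_eq_right hα0.le, add_zero] using h
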